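/- Let $N\in\mathbb N$, $1<p<\infty$, $m,\alpha_1,\alpha_2\in\mathbb R$ with $\alpha_2<2$. Let $\mathbb{R}^{N+1}_+=\{(x,y):x\in\mathbb R^N,\ y>0\}$ and $L^p_m=L^p(\mathbb R^{N+1}_+;\,y^m\,dx\,dy)$ (real or complex valued functions). Let $$W^{2,p}_{\mathcal N}(\alpha_1,\alpha_2,m)=\Big\{u\in W^{2,p}_{loc}(\mathbb R^{N+1}_+):\ u,\ y^{\alpha_1}D_{x_ix_j}u,\ y^{\frac{\alpha_1}{2}}D_{x_i}u,\ y^{\alpha_2}D_{yy}u,\ y^{\frac{\alpha_2}{2}}D_yu,\ y^{\alpha_2-1}D_yu\in L^p_m\Big\}$$ with the norm $$\|u\|_{L^p_m}+\sum_{i,j=1}^N\|y^{\alpha_1}D_{x_ix_j}u\|_{L^p_m}+\sum_{i=1}^N\|y^{\frac{\alpha_1}{2}}D_{x_i}u\|_{L^p_m}+\|y^{\alpha_2}D_{yy}u\|_{L^p_m}+\|y^{\frac{\alpha_2}{2}}D_yu\|_{L^p_m}+\|y^{\alpha_2-1}D_yu\|_{L^p_m}.$$ Assume that $\frac{m+1}{p}\ge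 2-\alpha_2$ and $\frac{m+1}{p}>\alpha_1^-$, where $\alpha_1^-=\max\{-\alpha_1,0\}$. Then both $C_c^\infty(\mathbb R^{N+1}_+)$ (smooth functions with compact support in the open half-space) and $$C_c^\infty(\mathbb R^N)\otimes C_c^\infty(]0,\infty[)=\Big\{\sum_{k=1}^n f_k(x)g_k(y):\ n\in\mathbb N,\ f_k\in C_c^\infty(\mathbb R^N),\ g_k\in C_c^\infty(]0,\infty[)\Big\}$$ are contained in $W^{2,p}_{\mathcal N}(\alpha_1,\alpha_2,m)$ and dense in it. -/

import Mathlib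

open MeasureTheory Set TopologicalSpace
open scoped ENNReal

noncomputable section

namespace WeightedSobolev

/-- The ambient space of points `(x, y)` with `x` in `ℝ^N` and `y` in `ℝ`. -/
abbrev Space (N : ℕ) : Type := EuclideanSpace ℝ (Fin N) × ℝ

/-- The open half-space of the points `(x, y)` with `y > 0`. -/
def halfSpace (N : ℕ) : Opens (Space N) :=
  ⟨{z | 0 < z.2}, isOpen_lt continuous_const continuous_snd⟩

/-- The open half-line `]0, ∞[`. -/
def halfLine : Opens ℝ := ⟨Ioi 0, isOpen_Ioi⟩

/-- The unit coordinate vectors: `some i` is the direction of `x_i`, `none` that of `y`. -/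
def dir (N : ℕ) : Option (Fin N) → Space N
  | some i => (EuclideanSpace.single i 1, 0)
  | none => (0, 1)

section Weak

variable {𝕜 : Type*} [RCLike 𝕜] {N : ℕ}

/-- `g` is a weak derivative of `u` in the half-space, in the coordinate direction `i`:
`∫ (D_i φ) u = - ∫ φ g` for all real test functions `φ` with compact support in the (open)
half-space. Only the values of `u` and `g` on the half-space matter. -/
structure HasWeakDeriv (i : Option (Fin N)) (u g : Space N → 𝕜) : Prop where
  locallyIntegrableOn : LocallyIntegrableOn u (halfSpace N) volume
  locallyIntegrableOn_deriv : LocallyIntegrableOn g (halfSpace N) volume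
  integral_eq : ∀ φ : TestFunction (halfSpace N) ℝ ⊤,
    ∫ z in (halfSpace N : Set (Space N)), lineDeriv ℝ φ z (dir N i) • u z =
      -∫ z in (halfSpace N : Set (Space N)), φ z • g z

/-- Weak derivatives are unique up to null sets. -/
theorem HasWeakDeriv.ae_unique {i : Option (Fin N)} {u g h : Space N → 𝕜}
    (hg : HasWeakDeriv i u g) (hh : HasWeakDeriv i u h) :
    ∀ᵐ z ∂(volume : Measure (Space N)), z ∈ halfSpace N → g z = h z := by
  have key : ∀ᵐ z ∂(volume : Measure (Space N)), z ∈ halfSpace N → (g - h) z = 0 := by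
    refine (halfSpace N).isOpen.ae_eq_zero_of_integral_contDiff_smul_eq_zero
      (hg.locallyIntegrableOn_deriv.sub hh.locallyIntegrableOn_deriv) ?_
    intro f hf hc hs
    let φ : TestFunction (halfSpace N) ℝ ⊤ := ⟨f, hf, hc, hs⟩
    have e := (neg_injective ((hg.integral_eq φ).symm.trans (hh.integral_eq φ)) :
      ∫ z in (halfSpace N : Set (Space N)), f z • g z =
        ∫ z in (halfSpace N : Set (Space N)), f z • h z)
    have conv : ∀ k : Space N → 𝕜,
        ∫ z in (halfSpace N : Set (Space N)), f z • k z = ∫ z, f z • k z := fun k =>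
      setIntegral_eq_integral_of_forall_compl_eq_zero fun z hz => by
        rw [image_eq_zero_of_notMem_tsupport (fun hz' => hz (hs hz')), zero_smul]
    have int : ∀ k : Space N → 𝕜, LocallyIntegrableOn k (halfSpace N) volume →
        Integrable (fun z => f z • k z) volume := fun k hk => by
      have h1 : IntegrableOn (fun z => f z • k z) (tsupport f) volume :=
        ((hk.integrableOn_compact_subset hs hc).continuousOn_smul hf.continuous.continuousOn
          hc)
      refine (integrableOn_iff_integrable_of_support_subset ?_).1 h1
      intro z hz
      exact subset_tsupport f (fun h0 => hz (by simp [h0]))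
    rw [conv, conv] at e
    simp only [Pi.sub_apply, smul_sub]
    rw [integral_sub (int g hg.locallyIntegrableOn_deriv) (int h hh.locallyIntegrableOn_deriv),
      e, sub_self]
  filter_upwards [key] with z hz hzm
  exact sub_eq_zero.1 (hz hzm)

open Classical in
/-- The weak derivative `D_i u` in the half-space (unique almost everywhere when it exists;
the value is `0` when it does not). -/
def weakDeriv (i : Option (Fin N)) (u : Space N → 𝕜) : Space N → 𝕜 :=
  if h : ∃ g, HasWeakDeriv i u g then h.choose else 0

theorem hasWeakDeriv_weakDeriv {i : Option (Fin N)} {u g : Space N → 𝕜}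
    (h : HasWeakDeriv i u g) : HasWeakDeriv i u (weakDeriv i u) := by
  have h' : ∃ g, HasWeakDeriv i u g := ⟨g, h⟩
  rw [weakDeriv, dif_pos h']
  exact h'.choose_spec

/-- `u` is in `L^p` on every compact subset of the open half-space. -/
def MemLpLoc (p : ℝ) (u : Space N → 𝕜) : Prop :=
  ∀ K : Set (Space N), IsCompact K → K ⊆ halfSpace N →
    MemLp u (ENNReal.ofReal p) (volume.restrict K)

/-- `W^{1,p}_loc` of the half-space. -/
def MemW1pLoc (p : ℝ) (u : Space N → 𝕜) : Prop :=
  MemLpLoc p u ∧ ∀ i, (∃ g, HasWeakDeriv i u g) ∧ MemLpLoc p (weakDeriv i u)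

/-- `W^{2,p}_loc` of the half-space: all weak derivatives up to order two, mixed ones included,
exist and are in `L^p_loc`. -/
def MemW2pLoc (p : ℝ) (u : Space N → 𝕜) : Prop :=
  MemW1pLoc p u ∧ ∀ i, MemW1pLoc p (weakDeriv i u)

end Weak

section Weighted

/-- The measure `y^m dx dy` on the half-space. -/
def weightMeasure (N : ℕ) (m : ℝ) : Measure (Space N) :=
  (volume.restrict (halfSpace N : Set (Space N))).withDensity
    fun z => ENNReal.ofReal (z.2 ^ m)

variable {𝕜 : Type*} [RCLike 𝕜] {N : ℕ}

/-- The function `y^a f`. -/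
def weight (a : ℝ) (f : Space N → 𝕜) : Space N → 𝕜 := fun z => (z.2 ^ a) • f z

/-- Membership in `L^p_m = L^p(y^m dx dy)`. -/
def MemLpm (p m : ℝ) (f : Space N → 𝕜) : Prop :=
  MemLp f (ENNReal.ofReal p) (weightMeasure N m)

/-- The norm of `L^p_m`, with value `∞` allowed. -/
def normLpm (p m : ℝ) (f : Space N → 𝕜) : ℝ≥0∞ :=
  eLpNorm f (ENNReal.ofReal p) (weightMeasure N m)

/-- Membership in the weighted anisotropic Sobolev space `W^{2,p}(α₁, α₂, m)`. -/
structure MemW (p α₁ α₂ m : ℝ) (u : Space N → 𝕜) : Prop where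
  memW2pLoc : MemW2pLoc p u
  memLpm : MemLpm p m u
  memLpm_xx : ∀ i j : Fin N,
    MemLpm p m (weight α₁ (weakDeriv (some i) (weakDeriv (some j) u)))
  memLpm_x : ∀ i : Fin N, MemLpm p m (weight (α₁ / 2) (weakDeriv (some i) u))
  memLpm_yy : MemLpm p m (weight α₂ (weakDeriv none (weakDeriv none u)))
  memLpm_y : MemLpm p m (weight (α₂ / 2) (weakDeriv none u))

/-- The norm of `W^{2,p}(α₁, α₂, m)`. -/
def normW (p α₁ α₂ m : ℝ) (u : Space N → 𝕜) : ℝ≥0∞ :=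
  normLpm p m u
    + ∑ i : Fin N, ∑ j : Fin N,
        normLpm p m (weight α₁ (weakDeriv (some i) (weakDeriv (some j) u)))
    + ∑ i : Fin N, normLpm p m (weight (α₁ / 2) (weakDeriv (some i) u))
    + normLpm p m (weight α₂ (weakDeriv none (weakDeriv none u)))
    + normLpm p m (weight (α₂ / 2) (weakDeriv none u))

/-- Membership in `W^{2,p}_𝒩(α₁, α₂, m)`: moreover `y^{α₂ - 1} D_y u` is in `L^p_m`. -/
def MemWN (p α₁ α₂ m : ℝ) (u : Space N → 𝕜) : Prop :=
  MemW p α₁ α₂ m u ∧ MemLpm p m (weight (α₂ - 1) (weakDeriv none u))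

/-- The norm of `W^{2,p}_𝒩(α₁, α₂, m)`. -/
def normWN (p α₁ α₂ m : ℝ) (u : Space N → 𝕜) : ℝ≥0∞ :=
  normW p α₁ α₂ m u + normLpm p m (weight (α₂ - 1) (weakDeriv none u))

/-- A set `S` of functions is contained in `W^{2,p}_𝒩(α₁, α₂, m)` and dense in it for its norm. -/
def IsDenseInWN (p α₁ α₂ m : ℝ) (S : Set (Space N → 𝕜)) : Prop :=
  (∀ φ ∈ S, MemWN p α₁ α₂ m φ) ∧
    ∀ u : Space N → 𝕜, MemWN p α₁ α₂ m u → ∀ ε : ℝ≥0∞, 0 < ε →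
      ∃ φ ∈ S, normWN p α₁ α₂ m (u - φ) < ε

end Weighted

/-- Smooth functions with compact support in the open half-space. -/
def smoothCompact (𝕜 : Type*) [RCLike 𝕜] (N : ℕ) : Set (Space N → 𝕜) :=
  {φ | ∃ f : TestFunction (halfSpace N) 𝕜 ⊤, φ = f}

/-- The tensor product of the smooth compactly supported functions on `ℝ^N` and on `]0, ∞[`:
finite sums of the functions `f(x) g(y)`. -/
def smoothCompactTensor (𝕜 : Type*) [RCLike 𝕜] (N : ℕ) : Set (Space N → 𝕜) :=
  {φ | ∃ (n : ℕ) (f : Fin n → TestFunction (⊤ : Opens (EuclideanSpace ℝ (Fin N))) 𝕜 ⊤)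
      (g : Fin n → TestFunction halfLine 𝕜 ⊤),
      φ = fun z => ∑ k, f k z.1 * g k z.2}

end WeightedSobolev

end

/-!
The substitution `y = exp s` maps the half-space to the whole space `ℝ^N × ℝ`. It turns `y D_y`
into `D_s` and every term of the norm into an `L^p` norm with an exponential weight `exp (a s)`:
with `c = (m + 1) / p` the exponent `a` is `c` for the function, `c + α₁ / 2` and `c + α₁` for the
derivatives in `x`, and `c + α₂ / 2 - 1` and `c + α₂ - 2` for the derivatives in `s`
(`Term.logExponent`). These weights are smooth and positive on the whole space, so that the
boundary has disappeared.

In these coordinates a function is first mollified. Since `exp (a s)` is multiplied by `exp (a t)`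
under a translation by `t`, mollification converges for all the weights at once
(`exists_eLpNorm_convolution_sub_le`), and the weak derivatives become classical. The smooth
function is then cut off, in three steps.

* For `s → +∞` a cutoff at `s = n` of fixed width is enough: as `α₂ < 2`, the weights of the
  derivatives in `s` are there at most that of the function, and dominated convergence controls the
  commutators (`MemLog.exists_vanishing_top`).
* For `s → -∞` the weight of `D_s u` exceeds that of `u`, and `exp (b s) u` with `b = c + α₂ - 2`
  need not be in `L^p`. The cutoff is now spread over `-2k ≤ s ≤ -k`, and its first derivative is of
  size `1 / k`. As `b ≥ 0`, and as `u` vanishes for `s ≥ S`, the value `exp (b s) |u|` is at most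
  the integral of `f = exp (b t) |D_t u|` over `[-2k, S]`. This integral is split at `-√k`, and
  Hölder's inequality on the two pieces bounds the `p`-th power of the `L^p` norm of the commutator
  by a constant times `((S + √k) / k) ^ (p - 1) ∫ f ^ p + ∫_{t < -√k} f ^ p`, which tends to zero as
  `p > 1` (`tendsto_eLpNorm_strip`, `MemLog.exists_vanishing_bot`). This is where the term
  `y ^ (α₂ - 1) D_y u` of the norm and the condition `2 - α₂ ≤ (m + 1) / p` are used.
* When `u` lives in a strip `|s| ≤ T` all the weights are equivalent, and a cutoff in `x` at scale
  `n` finishes (`MemLog.exists_hasCompactSupport_of_vanishing`).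

Finally the compactly supported function is mollified once more, with a kernel `J₁ (x) J₂ (s)`. The
Riemann sums of the convolution integral are finite sums of multiples of translates of the kernel,
hence tensor products, and they converge together with all their derivatives on a fixed compact set
(`exists_riemannSum`). Substituting `s = log y` preserves the tensor structure and the compactness
of the support, so that both families are dense.
-/


noncomputable section

open Filter Topology Convolution

/-! ### Mollification in weighted `L^p` -/

section LpTools

theorem eLpNorm_le_iff_lintegral_rpow_enorm_le {α F : Type*} [MeasurableSpace α] {μ : Measure α}
    [NormedAddCommGroup F] {p : ℝ≥0∞} (hp0 : p ≠ 0) (hp : p ≠ ∞) {f : α → F} {c : ℝ≥0∞} :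
    eLpNorm f p μ ≤ c ↔ ∫⁻ z, ‖f z‖ₑ ^ p.toReal ∂μ ≤ c ^ p.toReal := by
  rw [eLpNorm_eq_lintegral_rpow_enorm_toReal hp0 hp, one_div,
    ENNReal.rpow_inv_le_iff (ENNReal.toReal_pos hp0 hp)]

/-- Dominated convergence in `L^p`, for sequences that tend to zero. -/
theorem tendsto_eLpNorm_zero_of_dominated {α F : Type*} [MeasurableSpace α] {μ : Measure α}
    [NormedAddCommGroup F] {p : ℝ≥0∞} (hp : p ≠ ∞) {T : ℕ → α → F} {G : α → ℝ}
    (hT : ∀ n, AEStronglyMeasurable (T n) μ) (hG : MemLp G p μ)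
    (hle : ∀ n z, ‖T n z‖ ≤ G z) (hlim : ∀ z, Tendsto (fun n => T n z) atTop (𝓝 0)) :
    Tendsto (fun n => eLpNorm (T n) p μ) atTop (𝓝 0) := by
  rcases eq_or_ne p 0 with rfl | hp0
  · simp
  have hq : 0 < p.toReal := ENNReal.toReal_pos hp0 hp
  simp_rw [eLpNorm_eq_lintegral_rpow_enorm_toReal hp0 hp]
  have key : Tendsto (fun n => ∫⁻ z, ‖T n z‖ₑ ^ p.toReal ∂μ) atTop (𝓝 (∫⁻ _, 0 ∂μ)) := by
    refine tendsto_lintegral_of_dominated_convergence' (fun z => ‖G z‖ₑ ^ p.toReal)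
      (fun n => (hT n).enorm.pow_const _) (fun n => Eventually.of_forall fun z => ?_)
      (lintegral_rpow_enorm_lt_top_of_eLpNorm_lt_top hp0 hp hG.2).ne
      (Eventually.of_forall fun z => ?_)
    · refine ENNReal.rpow_le_rpow ?_ hq.le
      rw [enorm_le_iff_norm_le]
      exact (hle n z).trans (le_abs_self _)
    · have := ((ENNReal.continuous_rpow_const (y := p.toReal)).tendsto _).comp
        ((continuous_enorm.tendsto _).comp (hlim z))
      simpa [Function.comp_def, hq] using this
  have := ((ENNReal.continuous_rpow_const (y := 1 / p.toReal)).tendsto _).comp key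
  simpa [Function.comp_def, hq] using this

variable {E F : Type*} [NormedAddCommGroup E] [NormedSpace ℝ E] [FiniteDimensional ℝ E]
  [MeasurableSpace E] [BorelSpace E] {μ : Measure E} [μ.IsAddHaarMeasure]
  [NormedAddCommGroup F] {p : ℝ≥0∞}

/-- Translations act continuously on `L^p`. -/
theorem tendsto_eLpNorm_translate_sub (hp1 : 1 ≤ p) (hp : p ≠ ∞) {H : E → F}
    (hH : MemLp H p μ) :
    Tendsto (fun w => eLpNorm (fun z => H (z - w) - H z) p μ) (𝓝 0) (𝓝 0) := by
  have : Fact (1 ≤ p) := ⟨hp1⟩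
  have hmp : ∀ w : E, MeasurePreserving (fun z => z - w) μ μ := fun w =>
    measurePreserving_sub_right μ w
  let g : E → C(E, E) := fun w => ⟨fun z => z - w, by fun_prop⟩
  have hg : Continuous g :=
    (ContinuousMap.curry ⟨fun a : E × E => a.2 - a.1, by fun_prop⟩).continuous
  have key := Continuous.compMeasurePreservingLp (p := p) (μ := μ) (ν := μ) (f := fun _ : E =>
    hH.toLp H) continuous_const hg (fun w => hmp w) hp
  have h2 := (tendsto_iff_edist_tendsto_0.1 (key.tendsto 0))
  refine h2.congr fun w => ?_
  rw [Lp.edist_def]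
  refine eLpNorm_congr_ae ?_
  have e : ∀ w : E, (Lp.compMeasurePreserving (g w) (hmp w) (hH.toLp H) : E → F) =ᵐ[μ]
      fun z => H (z - w) := fun w =>
    (Lp.coeFn_compMeasurePreserving _ (hmp w)).trans
      ((hmp w).quasiMeasurePreserving.ae_eq_comp hH.coeFn_toLp)
  filter_upwards [e w, e 0] with z h1 h2
  simp only [Pi.sub_apply]
  rw [h1, h2, sub_zero]

/-- Approximation of a function by its mollifications, in the `L^p` norm with the weight
`exp (L z)`. The weighted error is an average over `w` of the weighted differences between the
translates of `f` by `w` and `f`, and Jensen's inequality bounds its `L^p` norm by the largest one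
of the `L^p` norms of these differences. -/
theorem exists_eLpNorm_convolution_sub_le [NormedSpace ℝ F] [CompleteSpace F] (hp1 : 1 ≤ p)
    (hp : p ≠ ∞) (L : E →L[ℝ] ℝ)
    {f : E → F} (hf : MemLp (fun z => Real.exp (L z) • f z) p μ) {η : ℝ≥0∞} (hη : 0 < η) :
    ∃ δ : ℝ, 0 < δ ∧ ∀ K : E → ℝ, Continuous K → (∀ w, 0 ≤ K w) → ∫ w, K w ∂μ = 1 →
      Function.support K ⊆ Metric.ball 0 δ →
      eLpNorm (fun z => Real.exp (L z) • ((K ⋆[ContinuousLinearMap.lsmul ℝ ℝ, μ] f) z - f z)) p μ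
        ≤ η := by
  have hp0 : p ≠ 0 := (zero_lt_one.trans_le hp1).ne'
  have hq1 : 1 ≤ p.toReal := by
    simpa using ENNReal.toReal_mono hp hp1
  set H : E → F := fun z => Real.exp (L z) • f z with hHdef
  have hfH : f = fun z => Real.exp (-L z) • H z := by
    funext z; simp [hHdef, smul_smul, ← Real.exp_add]
  have hcont : Continuous fun z => Real.exp (-L z) := by fun_prop
  have hfm : AEStronglyMeasurable f μ := by
    rw [hfH]; exact hcont.aestronglyMeasurable.smul hf.1
  have hfloc : LocallyIntegrable f μ := by
    rw [hfH]
    exact (hf.locallyIntegrable hp1).continuous_smul hcont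
  set D : E → E → F := fun w z => Real.exp (L z) • (f (z - w) - f z) with hD
  -- as `L` is linear, translations are continuous in the weighted norm as well
  have hDlim : Tendsto (fun w => eLpNorm (D w) p μ) (𝓝 0) (𝓝 0) := by
    have e : ∀ w, D w = (fun z => Real.exp (L w) • (H (z - w) - H z)) +
        fun z => (Real.exp (L w) - 1) • H z := by
      intro w; funext z
      simp only [hD, hHdef, Pi.add_apply, smul_sub, smul_smul, sub_mul, one_mul, sub_smul,
        ← Real.exp_add, map_sub]
      rw [add_sub_cancel]; abel
    have hsh : ∀ w, AEStronglyMeasurable (fun z => H (z - w)) μ := fun w =>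
      hf.1.comp_measurePreserving (measurePreserving_sub_right μ w)
    have b : ∀ w, eLpNorm (D w) p μ ≤ ‖Real.exp (L w)‖ₑ *
        eLpNorm (fun z => H (z - w) - H z) p μ + ‖Real.exp (L w) - 1‖ₑ * eLpNorm H p μ := by
      intro w
      rw [e w]
      refine (eLpNorm_add_le (((hsh w).sub hf.1).const_smul _) (hf.1.const_smul _) hp1).trans ?_
      exact add_le_add (eLpNorm_const_smul_le (c := Real.exp (L w)) (f := fun z => H (z - w) - H z))
        (eLpNorm_const_smul_le (c := Real.exp (L w) - 1) (f := H))
    have l1 : Tendsto (fun w : E => ‖Real.exp (L w)‖ₑ) (𝓝 0) (𝓝 1) := by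
      have : Continuous fun w : E => ‖Real.exp (L w)‖ₑ := by fun_prop
      simpa using this.tendsto 0
    have l2 : Tendsto (fun w : E => ‖Real.exp (L w) - 1‖ₑ) (𝓝 0) (𝓝 0) := by
      have : Continuous fun w : E => ‖Real.exp (L w) - 1‖ₑ := by fun_prop
      simpa using this.tendsto 0
    have l3 := (ENNReal.Tendsto.mul l1 (Or.inl one_ne_zero)
      (tendsto_eLpNorm_translate_sub hp1 hp hf) (Or.inr ENNReal.one_ne_top)).add
      (ENNReal.Tendsto.mul_const l2 (Or.inr hf.2.ne))
    simp only [mul_zero, zero_mul, add_zero] at l3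
    exact tendsto_of_tendsto_of_tendsto_of_le_of_le tendsto_const_nhds l3 (fun _ => zero_le) b
  obtain ⟨δ, hδ, hball⟩ := Metric.eventually_nhds_iff_ball.1
    (hDlim.eventually (ge_mem_nhds hη : ∀ᶠ x in 𝓝 (0 : ℝ≥0∞), x ≤ η))
  refine ⟨δ, hδ, fun K hK hK0 hK1 hKs => ?_⟩
  have hKi : Integrable K μ := by
    by_contra h
    rw [integral_undef h] at hK1; exact zero_ne_one hK1
  have hKc : HasCompactSupport K := by
    refine HasCompactSupport.of_support_subset_isCompact (isCompact_closedBall (0 : E) δ)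
      (hKs.trans Metric.ball_subset_closedBall)
  -- the convolution with `K` is the mean of the translates with respect to the probability `ν`
  set ν : Measure E := μ.withDensity fun w => ENNReal.ofReal (K w) with hν
  have hKm : Measurable fun w => ENNReal.ofReal (K w) := hK.measurable.ennreal_ofReal
  have : IsProbabilityMeasure ν := ⟨by
    rw [hν, withDensity_apply _ MeasurableSet.univ, Measure.restrict_univ,
      ← ofReal_integral_eq_lintegral_ofReal hKi (Eventually.of_forall hK0), hK1,
      ENNReal.ofReal_one]⟩
  have hνμ : ν ≪ μ := withDensity_absolutelyContinuous _ _
  have hνI : ∀ g : E → F, ∫ w, g w ∂ν = ∫ w, K w • g w ∂μ := fun g => by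
    have : (fun w => ENNReal.ofReal (K w)) = fun w => ((Real.toNNReal (K w) : NNReal) : ℝ≥0∞) := rfl
    rw [hν, this, integral_withDensity_eq_integral_smul hK.measurable.real_toNNReal]
    refine integral_congr_ae (Eventually.of_forall fun w => ?_)
    simp [NNReal.smul_def, hK0 w]
  have hconv : ∀ z, Integrable (fun w => K w • f (z - w)) μ := fun z =>
    (hKc.convolutionExists_left (ContinuousLinearMap.lsmul ℝ ℝ) hK hfloc z)
  have hrep : ∀ z, Real.exp (L z) • ((K ⋆[ContinuousLinearMap.lsmul ℝ ℝ, μ] f) z - f z) =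
      ∫ w, D w z ∂ν := by
    intro z
    rw [hνI]
    have : ∀ w, K w • D w z = Real.exp (L z) • (K w • f (z - w) - K w • f z) := fun w => by
      simp only [hD]; rw [smul_comm, smul_sub]
    simp_rw [this]
    rw [integral_smul, integral_sub (hconv z) (hKi.smul_const _), integral_smul_const, hK1,
      one_smul]
    rfl
  have hDm : AEStronglyMeasurable (fun x : E × E => D x.2 x.1) (μ.prod ν) := by
    have h1 : AEStronglyMeasurable (fun x : E × E => f (x.1 - x.2)) (μ.prod ν) :=
      (hfm.comp_quasiMeasurePreserving (quasiMeasurePreserving_sub μ μ)).mono_ac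
        (Measure.AbsolutelyContinuous.rfl.prod hνμ)
    have h2 : AEStronglyMeasurable (fun x : E × E => f x.1) (μ.prod ν) :=
      hfm.comp_fst
    have h3 : Continuous fun x : E × E => Real.exp (L x.1) := by fun_prop
    exact h3.aestronglyMeasurable.smul (h1.sub h2)
  have hDm' : ∀ᵐ z ∂μ, AEStronglyMeasurable (fun w => D w z) ν := hDm.prodMk_left
  rw [eLpNorm_le_iff_lintegral_rpow_enorm_le hp0 hp]
  calc ∫⁻ z, ‖Real.exp (L z) • ((K ⋆[ContinuousLinearMap.lsmul ℝ ℝ, μ] f) z - f z)‖ₑ ^ p.toReal ∂μ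
      ≤ ∫⁻ z, ∫⁻ w, ‖D w z‖ₑ ^ p.toReal ∂ν ∂μ := by
        refine lintegral_mono_ae ?_
        filter_upwards [hDm'] with z hz
        rw [hrep z]
        have h1 : ‖∫ w, D w z ∂ν‖ₑ ≤ eLpNorm (fun w => D w z) 1 ν := by
          rw [eLpNorm_one_eq_lintegral_enorm]; exact enorm_integral_le_lintegral_enorm _
        have h2 := h1.trans (eLpNorm_le_eLpNorm_of_exponent_le hp1 hz)
        rw [eLpNorm_eq_lintegral_rpow_enorm_toReal hp0 hp] at h2
        calc _ ≤ _ := ENNReal.rpow_le_rpow h2 (zero_le_one.trans hq1)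
          _ = _ := by rw [← ENNReal.rpow_mul, one_div_mul_cancel (by positivity), ENNReal.rpow_one]
    _ = ∫⁻ w, ∫⁻ z, ‖D w z‖ₑ ^ p.toReal ∂μ ∂ν :=
        lintegral_lintegral_swap (hDm.enorm.pow_const _)
    _ ≤ ∫⁻ _, η ^ p.toReal ∂ν := by
        rw [hν, lintegral_withDensity_eq_lintegral_mul_non_measurable _ hKm (by simp),
          lintegral_withDensity_eq_lintegral_mul_non_measurable _ hKm (by simp)]
        refine lintegral_mono fun w => ?_
        simp only [Pi.mul_apply]
        by_cases hw : K w = 0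
        · simp [hw]
        · gcongr
          exact (eLpNorm_le_iff_lintegral_rpow_enorm_le hp0 hp).1 (hball w (hKs hw))
    _ = η ^ p.toReal := by simp
end LpTools

open scoped ContDiff

/-! ### Iterated derivatives, classical and weak -/

section WholeSpace

variable {E F : Type*} [NormedAddCommGroup E] [NormedSpace ℝ E]
  [NormedAddCommGroup F] [NormedSpace ℝ F]

/-- The iterated derivative of `f` in the directions listed in `l`, the head of the list being the
last one to be applied. -/
def iterDeriv : List E → (E → F) → E → F
  | [], f => f
  | v :: l, f => fun z => fderiv ℝ (iterDeriv l f) z v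

theorem contDiff_iterDeriv {f : E → F} (hf : ContDiff ℝ ∞ f) (l : List E) :
    ContDiff ℝ ∞ (iterDeriv l f) := by
  induction l with
  | nil => exact hf
  | cons v l ih => exact (ih.fderiv_right (m := ∞) (by simp)).clm_apply contDiff_const

theorem tsupport_iterDeriv_subset (f : E → F) (l : List E) :
    tsupport (iterDeriv l f) ⊆ tsupport f := by
  induction l with
  | nil => exact subset_rfl
  | cons v l ih => exact (tsupport_fderiv_apply_subset ℝ v).trans ih

theorem HasCompactSupport.iterDeriv {f : E → F} (hf : HasCompactSupport f) (l : List E) :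
    HasCompactSupport (iterDeriv l f) :=
  hf.of_isClosed_subset (isClosed_tsupport _) (tsupport_iterDeriv_subset f l)

theorem iterDeriv_comp_sub (f : E → F) (w : E) (l : List E) :
    iterDeriv l (fun z => f (z - w)) = fun z => iterDeriv l f (z - w) := by
  induction l with
  | nil => rfl
  | cons v l ih =>
    funext z
    simp only [iterDeriv, ih]
    rw [fderiv_comp_sub]

theorem iterDeriv_sub {f g : E → F} (hf : ContDiff ℝ ∞ f) (hg : ContDiff ℝ ∞ g) (l : List E) :
    iterDeriv l (f - g) = iterDeriv l f - iterDeriv l g := by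
  induction l with
  | nil => rfl
  | cons v l ih =>
    funext z
    simp only [iterDeriv, ih, Pi.sub_apply]
    rw [fderiv_sub ((contDiff_iterDeriv hf l).differentiable (by simp) z)
      ((contDiff_iterDeriv hg l).differentiable (by simp) z)]
    rfl

theorem iterDeriv_sum {ι : Type*} {s : Finset ι} {f : ι → E → F}
    (hf : ∀ i, ContDiff ℝ ∞ (f i)) (l : List E) :
    iterDeriv l (fun z => ∑ i ∈ s, f i z) = fun z => ∑ i ∈ s, iterDeriv l (f i) z := by
  induction l with
  | nil => rfl
  | cons v l ih =>
    funext z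
    simp only [iterDeriv, ih]
    rw [fderiv_fun_sum fun i _ => (contDiff_iterDeriv (hf i) l).differentiable (by simp) z]
    simp

theorem iterDeriv_smul_const {f : E → ℝ} (hf : ContDiff ℝ ∞ f) (c : F) (l : List E) :
    iterDeriv l (fun z => f z • c) = fun z => iterDeriv l f z • c := by
  induction l with
  | nil => rfl
  | cons v l ih =>
    funext z
    simp only [iterDeriv, ih]
    rw [fderiv_smul_const ((contDiff_iterDeriv hf l).differentiable (by simp) z)]
    simp

variable [MeasurableSpace E] [BorelSpace E]

/-- `g` is a weak derivative of `f` in the direction `v`, on the whole space. -/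
structure IsWeakDeriv (μ : Measure E) (v : E) (f g : E → F) : Prop where
  locallyIntegrable : LocallyIntegrable f μ
  locallyIntegrable_deriv : LocallyIntegrable g μ
  integral_eq : ∀ ψ : E → ℝ, ContDiff ℝ ∞ ψ → HasCompactSupport ψ →
    ∫ z, fderiv ℝ ψ z v • f z ∂μ = -∫ z, ψ z • g z ∂μ

/-- `g` is an iterated weak derivative of `f`, in the directions listed in `l`. -/
def IsIterWeakDeriv (μ : Measure E) : List E → (E → F) → (E → F) → Prop
  | [], f, g => f = g
  | v :: l, f, g => ∃ h, IsIterWeakDeriv μ l f h ∧ IsWeakDeriv μ v h g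

variable [FiniteDimensional ℝ E] {μ : Measure E} [μ.IsAddHaarMeasure]

theorem isWeakDeriv_fderiv {f : E → F} (hf : ContDiff ℝ ∞ f) (v : E) :
    IsWeakDeriv μ v f fun z => fderiv ℝ f z v := by
  have hf' : Continuous fun z => fderiv ℝ f z v :=
    (contDiff_iterDeriv hf [v]).continuous
  refine ⟨hf.continuous.locallyIntegrable, hf'.locallyIntegrable, fun ψ hψ hc => ?_⟩
  rw [integral_smul_fderiv_eq_neg_fderiv_smul_of_integrable, neg_neg]
  · exact ((contDiff_iterDeriv hψ [v]).continuous.smul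
      hf.continuous).integrable_of_hasCompactSupport (hc.iterDeriv [v]).smul_right
  · exact (hψ.continuous.smul hf').integrable_of_hasCompactSupport hc.smul_right
  · exact (hψ.continuous.smul hf.continuous).integrable_of_hasCompactSupport hc.smul_right
  · exact fun z _ => hψ.differentiable (by simp) z
  · exact fun z _ => hf.differentiable (by simp) z

theorem isIterWeakDeriv_iterDeriv {f : E → F} (hf : ContDiff ℝ ∞ f) (l : List E) :
    IsIterWeakDeriv μ l f (iterDeriv l f) := by
  induction l with
  | nil => rfl
  | cons v l ih => exact ⟨_, ih, isWeakDeriv_fderiv (contDiff_iterDeriv hf l) v⟩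

theorem fderiv_convolution_apply {K : E → ℝ} (hK : ContDiff ℝ ∞ K) (hKc : HasCompactSupport K)
    {f : E → F} (hf : LocallyIntegrable f μ) (z v : E) :
    fderiv ℝ (K ⋆[ContinuousLinearMap.lsmul ℝ ℝ, μ] f) z v =
      ((fun w => fderiv ℝ K w v) ⋆[ContinuousLinearMap.lsmul ℝ ℝ, μ] f) z := by
  rw [(hKc.hasFDerivAt_convolution_left (ContinuousLinearMap.lsmul ℝ ℝ : ℝ →L[ℝ] F →L[ℝ] F)
    (hK.of_le (by simp)) hf z).fderiv, convolution_def, ContinuousLinearMap.integral_apply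
    ((hKc.fderiv ℝ).convolutionExists_left
      ((ContinuousLinearMap.lsmul ℝ ℝ : ℝ →L[ℝ] F →L[ℝ] F).precompL E)
      (hK.continuous_fderiv (by simp)) hf z)]
  rfl

theorem iterDeriv_convolution_left {K : E → ℝ} (hK : ContDiff ℝ ∞ K) (hKc : HasCompactSupport K)
    {f : E → F} (hf : LocallyIntegrable f μ) (l : List E) :
    iterDeriv l (K ⋆[ContinuousLinearMap.lsmul ℝ ℝ, μ] f) =
      iterDeriv l K ⋆[ContinuousLinearMap.lsmul ℝ ℝ, μ] f := by
  induction l with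
  | nil => rfl
  | cons v l ih =>
    funext z
    simp only [iterDeriv, ih]
    exact fderiv_convolution_apply (contDiff_iterDeriv hK l) (hKc.iterDeriv l) hf z v

/-- The function `w ↦ K (z - w)` is a test function, so that a derivative of a mollification can be
moved to a weak derivative. -/
theorem fderiv_convolution_of_isWeakDeriv {v : E} {f g : E → F}
    (h : IsWeakDeriv μ v f g) {K : E → ℝ} (hK : ContDiff ℝ ∞ K) (hKc : HasCompactSupport K)
    (z : E) :
    fderiv ℝ (K ⋆[ContinuousLinearMap.lsmul ℝ ℝ, μ] f) z v =
      (K ⋆[ContinuousLinearMap.lsmul ℝ ℝ, μ] g) z := by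
  have hψ : ContDiff ℝ ∞ fun w => K (z - w) := hK.comp (contDiff_const.sub contDiff_id)
  have hψc : HasCompactSupport fun w => K (z - w) :=
    hKc.comp_homeomorph (Homeomorph.subLeft z)
  have e := h.integral_eq _ hψ hψc
  have hfd : ∀ w, fderiv ℝ (fun w => K (z - w)) w v = -fderiv ℝ K (z - w) v := fun w => by
    have h1 : HasFDerivAt (fun w : E => z - w) (-ContinuousLinearMap.id ℝ E) w :=
      (hasFDerivAt_id w).const_sub z
    have h2 := (hK.differentiable (by simp) (z - w)).hasFDerivAt.comp w h1
    rw [show fderiv ℝ (fun w => K (z - w)) w = _ from h2.fderiv]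
    simp
  rw [fderiv_convolution_apply hK hKc h.locallyIntegrable, convolution_lsmul_swap,
    convolution_lsmul_swap]
  simp_rw [hfd, neg_smul, integral_neg] at e
  exact neg_injective e

theorem iterDeriv_convolution {l : List E} {f g : E → F}
    (h : IsIterWeakDeriv μ l f g) {K : E → ℝ} (hK : ContDiff ℝ ∞ K) (hKc : HasCompactSupport K) :
    iterDeriv l (K ⋆[ContinuousLinearMap.lsmul ℝ ℝ, μ] f) =
      K ⋆[ContinuousLinearMap.lsmul ℝ ℝ, μ] g := by
  induction l generalizing g with
  | nil => rw [show f = g from h]; rfl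
  | cons v l ih =>
    obtain ⟨k, hk, hkg⟩ := h
    funext z
    simp only [iterDeriv, ih hk]
    exact fderiv_convolution_of_isWeakDeriv hkg hK hKc z

/-- One mollification approximates finitely many weak derivatives at once, each one in its own
exponentially weighted norm. -/
theorem exists_eLpNorm_iterDeriv_convolution_sub_le [CompleteSpace F] {ι : Type*} [Finite ι]
    {p : ℝ≥0∞} (hp1 : 1 ≤ p) (hp : p ≠ ⊤)
    {word : ι → List E} {L : ι → E →L[ℝ] ℝ} {f : E → F} {g : ι → E → F}
    (hfg : ∀ k, IsIterWeakDeriv μ (word k) f (g k))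
    (hg : ∀ k, MemLp (fun z => Real.exp (L k z) • g k z) p μ) {η : ℝ≥0∞} (hη : 0 < η) :
    ∃ δ : ℝ, 0 < δ ∧ ∀ K : E → ℝ, ContDiff ℝ ∞ K → (∀ w, 0 ≤ K w) → ∫ w, K w ∂μ = 1 →
      Function.support K ⊆ Metric.ball 0 δ → ∀ k,
      eLpNorm (fun z => Real.exp (L k z) •
        (iterDeriv (word k) (K ⋆[ContinuousLinearMap.lsmul ℝ ℝ, μ] f) z - g k z)) p μ ≤ η := by
  choose δ hδ h using fun k => exists_eLpNorm_convolution_sub_le hp1 hp (L k) (hg k) hη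
  have hev : ∀ᶠ x in 𝓝[>] (0 : ℝ), ∀ k, x ≤ δ k :=
    eventually_all.2 fun k => nhdsWithin_le_nhds (ge_mem_nhds (hδ k))
  obtain ⟨d, hd, hd0⟩ := (hev.and self_mem_nhdsWithin).exists
  refine ⟨d, hd0, fun K hK hK0 hK1 hKs k => ?_⟩
  have hKc : HasCompactSupport K :=
    HasCompactSupport.of_support_subset_isCompact (isCompact_closedBall (0 : E) d)
      (hKs.trans Metric.ball_subset_closedBall)
  rw [iterDeriv_convolution (hfg k) hK hKc]
  exact h k K hK.continuous hK0 hK1 (hKs.trans (Metric.ball_subset_ball (hd k)))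

end WholeSpace

/-- Smooth normalized kernels `K₁(x) K₂(y)` with support in an arbitrarily small ball. -/
theorem exists_product_kernel {X Y : Type*} [NormedAddCommGroup X] [InnerProductSpace ℝ X]
    [FiniteDimensional ℝ X] [MeasureSpace X] [BorelSpace X]
    [NormedAddCommGroup Y] [InnerProductSpace ℝ Y]
    [FiniteDimensional ℝ Y] [MeasureSpace Y] [BorelSpace Y]
    [(volume : Measure X).IsAddHaarMeasure] [(volume : Measure Y).IsAddHaarMeasure]
    {δ : ℝ} (hδ : 0 < δ) :
    ∃ (K₁ : X → ℝ) (K₂ : Y → ℝ), ContDiff ℝ ∞ K₁ ∧ ContDiff ℝ ∞ K₂ ∧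
      HasCompactSupport K₁ ∧ HasCompactSupport K₂ ∧ (∀ w : X × Y, 0 ≤ K₁ w.1 * K₂ w.2) ∧
      ∫ w : X × Y, K₁ w.1 * K₂ w.2 = 1 ∧
      Function.support (fun w : X × Y => K₁ w.1 * K₂ w.2) ⊆ Metric.ball 0 δ := by
  let b₁ : ContDiffBump (0 : X) := ⟨δ / 2, δ, by positivity, by linarith⟩
  let b₂ : ContDiffBump (0 : Y) := ⟨δ / 2, δ, by positivity, by linarith⟩
  refine ⟨b₁.normed volume, b₂.normed volume, b₁.contDiff_normed, b₂.contDiff_normed,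
    b₁.hasCompactSupport_normed, b₂.hasCompactSupport_normed,
    fun w => mul_nonneg (b₁.nonneg_normed _) (b₂.nonneg_normed _), ?_, ?_⟩
  · rw [Measure.volume_eq_prod, integral_prod_mul, b₁.integral_normed, b₂.integral_normed, one_mul]
  · intro w hw
    have h1 := left_ne_zero_of_mul hw
    have h2 := right_ne_zero_of_mul hw
    have h1' : w.1 ∈ Metric.ball (0 : X) δ := by
      have := b₁.support_normed_eq (μ := volume) ▸ (Function.mem_support.2 h1)
      exact this
    have h2' : w.2 ∈ Metric.ball (0 : Y) δ := by
      have := b₂.support_normed_eq (μ := volume) ▸ (Function.mem_support.2 h2)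
      exact this
    have : Metric.ball (0 : X × Y) δ = Metric.ball 0 δ ×ˢ Metric.ball 0 δ :=
      (ball_prod_same 0 0 δ).symm
    rw [this]; exact ⟨h1', h2'⟩

/-! ### The critical estimate near the boundary -/

section Strip

/-- Hölder's inequality against the constant function `1`. -/
theorem rpow_setLIntegral_le {α : Type*} [MeasurableSpace α] {μ : Measure α} {q : ℝ} (hq : 1 < q)
    {f : α → ℝ≥0∞} (hf : Measurable f) (A : Set α) :
    (∫⁻ x in A, f x ∂μ) ^ q ≤ μ A ^ (q - 1) * ∫⁻ x in A, f x ^ q ∂μ := by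
  have h := ENNReal.lintegral_mul_le_Lp_mul_Lq (μ.restrict A)
    (Real.HolderConjugate.conjExponent hq) hf.aemeasurable (g := fun _ => 1) aemeasurable_const
  simp only [Pi.mul_apply, mul_one, ENNReal.one_rpow, lintegral_const, Measure.restrict_apply,
    MeasurableSet.univ, univ_inter, one_mul] at h
  have hq0 : 0 < q := by linarith
  calc _ ≤ _ := ENNReal.rpow_le_rpow h hq0.le
    _ = _ := by
      rw [ENNReal.mul_rpow_of_nonneg _ _ hq0.le, ← ENNReal.rpow_mul, ← ENNReal.rpow_mul,
        one_div_mul_cancel hq0.ne', ENNReal.rpow_one, mul_comm]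
      congr 2
      rw [Real.conjExponent]
      have : q - 1 ≠ 0 := by linarith
      field_simp

/-- The mean of `f` over a long interval, measured with the power of the length that is critical
for Hölder's inequality, is small: cutting the interval at `-√k`, one part is short with respect
to `k` and the other one is far away. -/
theorem rpow_mul_setLIntegral_rpow_le {q : ℝ} (hq : 1 < q) {f : ℝ → ℝ≥0∞} (hf : Measurable f)
    {k S : ℝ} (hk : 0 < k) (hS : 0 ≤ S) :
    ENNReal.ofReal k ^ (1 - q) * (∫⁻ s in Icc (-(2 * k)) S, f s) ^ q ≤
      2 ^ (q - 1) * (ENNReal.ofReal ((S + √k) / k) ^ (q - 1) * (∫⁻ s, f s ^ q) +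
        2 ^ (q - 1) * ∫⁻ s in Iio (-√k), f s ^ q) := by
  have hq1 : 0 ≤ q - 1 := by linarith
  set A : Set ℝ := Icc (-√k) S
  set B : Set ℝ := Ico (-(2 * k)) (-√k)
  have hk0 : ENNReal.ofReal k ≠ 0 := by simpa using hk
  have hsub : Icc (-(2 * k)) S ⊆ A ∪ B := by
    intro s hs
    by_cases h : -√k ≤ s
    · exact Or.inl ⟨h, hs.2⟩
    · exact Or.inr ⟨hs.1, not_le.1 h⟩
  have hpow : ∀ r : ℝ, 0 ≤ r → ENNReal.ofReal k ^ (1 - q) * ENNReal.ofReal r ^ (q - 1) =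
      ENNReal.ofReal (r / k) ^ (q - 1) := by
    intro r hr
    rw [ENNReal.ofReal_div_of_pos hk, ENNReal.div_rpow_of_nonneg _ _ hq1, div_eq_mul_inv,
      ← ENNReal.rpow_neg, neg_sub, mul_comm]
  have hA : volume A = ENNReal.ofReal (S + √k) := by
    simp [A, Real.volume_Icc]
  have hB : volume B ≤ ENNReal.ofReal (2 * k) := by
    simp only [B, Real.volume_Ico]
    exact ENNReal.ofReal_le_ofReal (by have := Real.sqrt_nonneg k; linarith)
  calc ENNReal.ofReal k ^ (1 - q) * (∫⁻ s in Icc (-(2 * k)) S, f s) ^ q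
      ≤ ENNReal.ofReal k ^ (1 - q) * ((∫⁻ s in A, f s) + ∫⁻ s in B, f s) ^ q := by
        gcongr
        exact (lintegral_mono_set hsub).trans (lintegral_union_le _ _ _)
    _ ≤ ENNReal.ofReal k ^ (1 - q) * (2 ^ (q - 1) *
          ((∫⁻ s in A, f s) ^ q + (∫⁻ s in B, f s) ^ q)) := by
        gcongr
        exact ENNReal.rpow_add_le_mul_rpow_add_rpow _ _ hq.le
    _ ≤ ENNReal.ofReal k ^ (1 - q) * (2 ^ (q - 1) *
          (ENNReal.ofReal (S + √k) ^ (q - 1) * (∫⁻ s, f s ^ q) +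
            ENNReal.ofReal (2 * k) ^ (q - 1) * ∫⁻ s in Iio (-√k), f s ^ q)) := by
        gcongr
        · refine (rpow_setLIntegral_le hq hf A).trans ?_
          rw [hA]
          gcongr
          exact Measure.restrict_le_self
        · refine (rpow_setLIntegral_le hq hf B).trans ?_
          gcongr
          exact Ico_subset_Iio_self
    _ = _ := by
        rw [mul_left_comm, mul_add, ← mul_assoc, ← mul_assoc, hpow _ (by positivity),
          hpow _ (by positivity), mul_div_cancel_right₀ _ hk.ne', ENNReal.ofReal_ofNat]

variable {X F : Type*} [MeasureSpace X] [TopologicalSpace X] [OpensMeasurableSpace X]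
  [NormedAddCommGroup F] [NormedSpace ℝ F] [CompleteSpace F]

/-- By the fundamental theorem of calculus from `S`, where `u` vanishes; as `b ≥ 0`, the weight at
`s` is at most the weights at the points of integration `t ≥ s`. -/
theorem enorm_exp_smul_le_setLIntegral {u u' : ℝ → F} (hu : ∀ s, HasDerivAt u (u' s) s)
    (hu' : Continuous u') {b : ℝ} (hb : 0 ≤ b) {S T s : ℝ} (hS : u S = 0) (hTs : T ≤ s)
    (hsS : s ≤ S) :
    ‖Real.exp (b * s) • u s‖ₑ ≤ ∫⁻ t in Icc T S, ‖Real.exp (b * t) • u' t‖ₑ := by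
  have h := intervalIntegral.integral_eq_sub_of_hasDerivAt (fun t _ => hu t)
    (hu'.intervalIntegrable s S)
  rw [hS, zero_sub, intervalIntegral.integral_of_le hsS] at h
  rw [enorm_smul, ← enorm_neg (u s), ← h]
  calc _ ≤ ‖Real.exp (b * s)‖ₑ * ∫⁻ t in Ioc s S, ‖u' t‖ₑ := by
        gcongr; exact enorm_integral_le_lintegral_enorm _
    _ = ∫⁻ t in Ioc s S, ‖Real.exp (b * s)‖ₑ * ‖u' t‖ₑ := by
        rw [lintegral_const_mul _ hu'.enorm.measurable]
    _ ≤ ∫⁻ t in Ioc s S, ‖Real.exp (b * t) • u' t‖ₑ := by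
        refine setLIntegral_mono' measurableSet_Ioc fun t ht => ?_
        rw [enorm_smul]
        gcongr
        rw [enorm_le_iff_norm_le, Real.norm_of_nonneg (Real.exp_nonneg _),
          Real.norm_of_nonneg (Real.exp_nonneg _)]
        exact Real.exp_le_exp.2 (mul_le_mul_of_nonneg_left ht.1.le hb)
    _ ≤ _ := lintegral_mono_set (Ioc_subset_Icc_self.trans (Icc_subset_Icc_left hTs))

/-- The critical cutoff estimate: if `u` vanishes for large `s` and `exp (b s) ∂ₛu` is in `L^p`
with `b ≥ 0`, `p > 1`, then the commutator of `∂ₛ` with a cutoff at scale `k` near `s = -k` is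
small although `exp (b s) u` need not be in `L^p`. -/
theorem tendsto_eLpNorm_strip {p : ℝ≥0∞} (hp1 : 1 < p) (hp : p ≠ ⊤) {u u' : X × ℝ → F}
    (hu : Continuous u) (hu' : Continuous u')
    (hd : ∀ x s, HasDerivAt (fun s => u (x, s)) (u' (x, s)) s) {b S : ℝ} (hb : 0 ≤ b) (hS : 0 ≤ S)
    (huS : ∀ x s, S ≤ s → u (x, s) = 0)
    (hL : MemLp (fun z : X × ℝ => Real.exp (b * z.2) • u' z) p) :
    Tendsto (fun n : ℕ => eLpNorm (fun z : X × ℝ =>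
      (indicator (Icc (-(2 * ((n : ℝ) + 1))) (-((n : ℝ) + 1)))
        (fun s => ((n : ℝ) + 1)⁻¹ * Real.exp (b * s)) z.2) • u z) p volume) atTop (𝓝 0) := by
  have hp0 : p ≠ 0 := (zero_lt_one.trans hp1).ne'
  set q := p.toReal with hq
  have hq1 : 1 < q := by
    simpa using (ENNReal.toReal_lt_toReal ENNReal.one_ne_top hp).2 hp1
  have hq0 : 0 < q := by linarith
  set f : X → ℝ → ℝ≥0∞ := fun x s => ‖Real.exp (b * s) • u' (x, s)‖ₑ with hf
  have hcont : Continuous fun z : X × ℝ => Real.exp (b * z.2) • u' z := by fun_prop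
  have hfm2 : Measurable fun z : X × ℝ => f z.1 z.2 := hcont.enorm.measurable
  have hfm : ∀ x, Measurable (f x) := fun x => hfm2.comp measurable_prodMk_left
  -- after integration in `x`, the two terms on the right of `rpow_mul_setLIntegral_rpow_le` carry
  -- the factors `Φ` and `Ψ n`; the first one is finite and the second one tends to zero
  set Φ : ℝ≥0∞ := ∫⁻ x : X, ∫⁻ s, f x s ^ q with hΦ
  set Ψ : ℕ → ℝ≥0∞ := fun n => ∫⁻ x : X, ∫⁻ s in Iio (-√((n : ℝ) + 1)), f x s ^ q with hΨ
  have hfin : ∫⁻ z : X × ℝ, f z.1 z.2 ^ q < ⊤ :=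
    lintegral_rpow_enorm_lt_top_of_eLpNorm_lt_top hp0 hp hL.2
  have hΦ' : Φ ≠ ⊤ := by
    rw [hΦ, lintegral_lintegral (hfm2.pow_const q).aemeasurable]
    exact hfin.ne
  have hΨ' : Tendsto Ψ atTop (𝓝 0) := by
    have e : ∀ n, Ψ n = ∫⁻ z : X × ℝ, indicator {z : X × ℝ | z.2 < -√((n : ℝ) + 1)}
        (fun z => f z.1 z.2 ^ q) z := by
      intro n
      rw [Measure.volume_eq_prod, lintegral_prod _ ((Measurable.indicator (hfm2.pow_const q)
        (measurableSet_lt measurable_snd measurable_const)).aemeasurable)]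
      refine lintegral_congr fun x => ?_
      rw [← lintegral_indicator measurableSet_Iio]
      rfl
    rw [show Ψ = _ from funext e]
    rw [show (0 : ℝ≥0∞) = ∫⁻ _ : X × ℝ, 0 by simp]
    refine tendsto_lintegral_of_dominated_convergence (fun z => f z.1 z.2 ^ q)
      (fun n => Measurable.indicator (hfm2.pow_const q)
        (measurableSet_lt measurable_snd measurable_const))
      (fun n => Eventually.of_forall fun z => indicator_le_self _ _ z) hfin.ne
      (Eventually.of_forall fun z => ?_)
    refine tendsto_const_nhds.congr' ?_
    have : Tendsto (fun n : ℕ => √((n : ℝ) + 1)) atTop atTop :=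
      Real.tendsto_sqrt_atTop.comp (tendsto_atTop_add_const_right _ _ tendsto_natCast_atTop_atTop)
    filter_upwards [this.eventually_ge_atTop (-z.2)] with n hn
    rw [indicator_of_notMem]
    simp only [mem_ofPred_eq, not_lt]; linarith
  have hlim : Tendsto (fun n : ℕ => (2 : ℝ≥0∞) ^ (q - 1) *
      (ENNReal.ofReal ((S + √((n : ℝ) + 1)) / ((n : ℝ) + 1)) ^ (q - 1) * Φ +
        2 ^ (q - 1) * Ψ n)) atTop (𝓝 0) := by
    have hn : Tendsto (fun n : ℕ => (n : ℝ) + 1) atTop atTop :=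
      tendsto_atTop_add_const_right _ _ tendsto_natCast_atTop_atTop
    have h1 : Tendsto (fun n : ℕ => (S + √((n : ℝ) + 1)) / ((n : ℝ) + 1)) atTop (𝓝 0) := by
      have a1 : Tendsto (fun n : ℕ => S / ((n : ℝ) + 1)) atTop (𝓝 0) := hn.const_div_atTop S
      have a2 : Tendsto (fun n : ℕ => (√((n : ℝ) + 1))⁻¹) atTop (𝓝 0) :=
        tendsto_inv_atTop_zero.comp (Real.tendsto_sqrt_atTop.comp hn)
      have := a1.add a2
      rw [add_zero] at this
      refine this.congr fun n => ?_
      rw [add_div, Real.sqrt_div_self', one_div]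
    have h2 : Tendsto (fun n : ℕ => ENNReal.ofReal ((S + √((n : ℝ) + 1)) / ((n : ℝ) + 1)) ^ (q - 1))
        atTop (𝓝 0) := by
      have := ((ENNReal.continuous_rpow_const (y := q - 1)).tendsto _).comp
        (ENNReal.tendsto_ofReal h1)
      simpa [Function.comp_def, sub_pos.2 hq1] using this
    have h3 := ENNReal.Tendsto.mul_const h2 (Or.inr hΦ')
    have h4 := ENNReal.Tendsto.const_mul (a := 2 ^ (q - 1)) hΨ'
      (Or.inr (ENNReal.rpow_ne_top_of_nonneg (by linarith) (by simp)))
    have h5 := ENNReal.Tendsto.const_mul (a := 2 ^ (q - 1)) (h3.add h4)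
      (Or.inr (ENNReal.rpow_ne_top_of_nonneg (by linarith) (by simp)))
    simpa using h5
  have hroot := ((ENNReal.continuous_rpow_const (y := q⁻¹)).tendsto _).comp hlim
  simp only [Function.comp_def, ENNReal.zero_rpow_of_pos (inv_pos.2 hq0)] at hroot
  refine tendsto_of_tendsto_of_tendsto_of_le_of_le tendsto_const_nhds hroot (fun _ => zero_le)
    fun n => ?_
  simp only
  rw [ENNReal.le_rpow_inv_iff hq0, ← ENNReal.le_rpow_inv_iff hq0,
    eLpNorm_le_iff_lintegral_rpow_enorm_le hp0 hp, ← hq, ENNReal.rpow_inv_rpow hq0.ne']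
  set k : ℝ := (n : ℝ) + 1 with hk
  have hk0 : 0 < k := by positivity
  have hmeas : Measurable fun z : X × ℝ => ‖(indicator (Icc (-(2 * k)) (-k))
        (fun s => k⁻¹ * Real.exp (b * s)) z.2) • u z‖ₑ ^ q := by
    have h1 : Measurable fun z : X × ℝ => indicator (Icc (-(2 * k)) (-k))
        (fun s => k⁻¹ * Real.exp (b * s)) z.2 :=
      (Measurable.indicator (by fun_prop) measurableSet_Icc).comp measurable_snd
    have h2 : Measurable fun z : X × ℝ => ‖u z‖ₑ := hu.enorm.measurable
    simp_rw [enorm_smul]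
    exact (h1.enorm.mul h2).pow_const q
  rw [Measure.volume_eq_prod, lintegral_prod _ hmeas.aemeasurable]
  have hfq : Measurable fun x : X => ∫⁻ s, f x s ^ q := (hfm2.pow_const q).lintegral_prod_right'
  have hfq' : Measurable fun x : X => ∫⁻ s in Iio (-√k), f x s ^ q :=
    (hfm2.pow_const q).lintegral_prod_right'
  calc _ ≤ ∫⁻ x : X, 2 ^ (q - 1) *
      (ENNReal.ofReal ((S + √k) / k) ^ (q - 1) * (∫⁻ s, f x s ^ q) +
        2 ^ (q - 1) * ∫⁻ s in Iio (-√k), f x s ^ q) := by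
        refine lintegral_mono fun x => ?_
        refine le_trans ?_ (rpow_mul_setLIntegral_rpow_le hq1 (hfm x) hk0 hS)
        have hpt : ∀ s, ‖(indicator (Icc (-(2 * k)) (-k))
            (fun s => k⁻¹ * Real.exp (b * s)) s) • u (x, s)‖ₑ ^ q ≤
            indicator (Icc (-(2 * k)) (-k)) (fun _ => ENNReal.ofReal k ^ (-q) *
              (∫⁻ s in Icc (-(2 * k)) S, f x s) ^ q) s := by
          intro s
          by_cases hs : s ∈ Icc (-(2 * k)) (-k)
          · rw [indicator_of_mem hs, indicator_of_mem hs, mul_smul, enorm_smul,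
              ENNReal.mul_rpow_of_nonneg _ _ hq0.le]
            gcongr
            · rw [Real.enorm_of_nonneg (by positivity), ENNReal.ofReal_inv_of_pos hk0,
                ENNReal.inv_rpow, ENNReal.rpow_neg]
            · exact enorm_exp_smul_le_setLIntegral (fun t => hd x t) (by fun_prop) hb
                (huS x S le_rfl) hs.1 (hs.2.trans (by linarith))
          · rw [indicator_of_notMem hs, indicator_of_notMem hs]
            simp [hq0]
        refine (lintegral_mono hpt).trans ?_
        rw [lintegral_indicator measurableSet_Icc, setLIntegral_const, Real.volume_Icc,
          show -k - -(2 * k) = k by ring, mul_right_comm]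
        gcongr
        have hk' : ENNReal.ofReal k ≠ 0 := by simpa using hk0
        rw [show 1 - q = -q + 1 by ring, ENNReal.rpow_add _ _ hk' ENNReal.ofReal_ne_top,
          ENNReal.rpow_one]
    _ = _ := by
        rw [lintegral_const_mul _ (by fun_prop), lintegral_add_left (by fun_prop),
          lintegral_const_mul _ hfq, lintegral_const_mul _ hfq']

end Strip

/-! ### Leibniz rules and a smooth step -/

section IterDeriv

variable {E X F : Type*} [NormedAddCommGroup E] [NormedSpace ℝ E]
  [NormedAddCommGroup X] [NormedSpace ℝ X] [NormedAddCommGroup F] [NormedSpace ℝ F]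

theorem Filter.EventuallyEq.iterDeriv {f g : E → F} {z : E} (h : f =ᶠ[𝓝 z] g) (l : List E) :
    iterDeriv l f =ᶠ[𝓝 z] iterDeriv l g := by
  induction l with
  | nil => exact h
  | cons v l ih => exact ih.fderiv.fun_comp (· v)

theorem iterDeriv_zero (l : List E) : iterDeriv l (0 : E → F) = 0 := by
  induction l with
  | nil => rfl
  | cons v l ih => funext z; simp [iterDeriv, ih]

theorem iterDeriv_const (c : F) (v : E) (l : List E) : iterDeriv (l ++ [v]) (fun _ => c) = 0 := by
  induction l with
  | nil => funext z; simp [iterDeriv]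
  | cons w l ih => funext z; simp [iterDeriv, ih]

theorem iterDeriv_comp_clm_add {f : X → F} (hf : ContDiff ℝ ∞ f) (A : E →L[ℝ] X) (b : X)
    (l : List E) :
    iterDeriv l (fun z => f (A z + b)) = fun z => iterDeriv (l.map A) f (A z + b) := by
  induction l with
  | nil => rfl
  | cons v l ih =>
    funext z
    simp only [iterDeriv, ih, List.map_cons]
    have h1 : HasFDerivAt (fun z : E => A z + b) A z := A.hasFDerivAt.add_const b
    have h2 := ((contDiff_iterDeriv hf (l.map A)).differentiable (by simp)
      (A z + b)).hasFDerivAt.comp z h1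
    rw [show fderiv ℝ (fun z => iterDeriv (l.map A) f (A z + b)) z = _ from h2.fderiv]
    rfl

theorem iterDeriv_map_smul (r : ℝ) {f : E → F} (hf : ContDiff ℝ ∞ f) (l : List E) :
    iterDeriv (l.map (r • ·)) f = fun z => r ^ l.length • iterDeriv l f z := by
  induction l with
  | nil => funext z; simp [iterDeriv]
  | cons v l ih =>
    funext z
    simp only [iterDeriv, ih, List.map_cons, List.length_cons]
    rw [fderiv_fun_const_smul ((contDiff_iterDeriv hf l).differentiable (by simp) z)]
    simp [smul_smul, pow_succ']

theorem iterDeriv_singleton_smul {ζ : E → ℝ} {u : E → F} (hζ : ContDiff ℝ ∞ ζ)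
    (hu : ContDiff ℝ ∞ u) (v : E) :
    iterDeriv [v] (fun z => ζ z • u z) =
      fun z => ζ z • iterDeriv [v] u z + iterDeriv [v] ζ z • u z := by
  funext z
  simp only [iterDeriv]
  rw [fderiv_fun_smul (hζ.differentiable (by simp) z) (hu.differentiable (by simp) z)]
  simp

theorem iterDeriv_pair_smul {ζ : E → ℝ} {u : E → F} (hζ : ContDiff ℝ ∞ ζ)
    (hu : ContDiff ℝ ∞ u) (v w : E) :
    iterDeriv [v, w] (fun z => ζ z • u z) = fun z => (ζ z • iterDeriv [v, w] u z
      + iterDeriv [v] ζ z • iterDeriv [w] u z) + (iterDeriv [w] ζ z • iterDeriv [v] u z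
      + iterDeriv [v, w] ζ z • u z) := by
  have h1 : iterDeriv [v, w] (fun z => ζ z • u z) =
      iterDeriv [v] (iterDeriv [w] fun z => ζ z • u z) := rfl
  rw [h1, iterDeriv_singleton_smul hζ hu]
  have hw := contDiff_iterDeriv hu [w]
  have hw' := contDiff_iterDeriv hζ [w]
  have e1 := iterDeriv_singleton_smul hζ hw v
  have e2 := iterDeriv_singleton_smul hw' hu v
  funext z
  have d1 : DifferentiableAt ℝ (fun z => ζ z • iterDeriv [w] u z) z :=
    (hζ.smul hw).differentiable (by simp) z
  have d2 : DifferentiableAt ℝ (fun z => iterDeriv [w] ζ z • u z) z :=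
    (hw'.smul hu).differentiable (by simp) z
  change fderiv ℝ (fun z => ζ z • iterDeriv [w] u z + iterDeriv [w] ζ z • u z) z v = _
  rw [fderiv_fun_add d1 d2]
  exact congrArg₂ (· + ·) (congrFun e1 z) (congrFun e2 z)

end IterDeriv

/-- A smooth step from `0` to `1` across the unit interval, with bounded derivatives. -/
theorem exists_smooth_step : ∃ (ρ : ℝ → ℝ) (C : ℝ), ContDiff ℝ ∞ ρ ∧ (∀ t, |ρ t| ≤ 1) ∧
    (∀ t ≤ 0, ρ t = 0) ∧ (∀ t, 1 ≤ t → ρ t = 1) ∧ 0 ≤ C ∧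
    (∀ t, |iterDeriv [1] ρ t| ≤ C) ∧ (∀ t, |iterDeriv [1, 1] ρ t| ≤ C) ∧
    (∀ t, t ∉ Icc (0 : ℝ) 1 → iterDeriv [1] ρ t = 0 ∧ iterDeriv [1, 1] ρ t = 0) := by
  have hρ : ContDiff ℝ ∞ Real.smoothTransition := Real.smoothTransition.contDiff
  have hz : ∀ (l : List ℝ) (t : ℝ), t ∉ Icc (0 : ℝ) 1 →
      iterDeriv (l ++ [1]) Real.smoothTransition t = 0 := by
    intro l t ht
    rw [mem_Icc, not_and_or, not_le, not_le] at ht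
    rcases ht with ht | ht
    · have h : Real.smoothTransition =ᶠ[𝓝 t] fun _ => 0 := by
        filter_upwards [Iio_mem_nhds ht] with s hs
        exact Real.smoothTransition.zero_of_nonpos (le_of_lt hs)
      rw [(h.iterDeriv _).eq_of_nhds, iterDeriv_const]; rfl
    · have h : Real.smoothTransition =ᶠ[𝓝 t] fun _ => 1 := by
        filter_upwards [Ioi_mem_nhds ht] with s hs
        exact Real.smoothTransition.one_of_one_le (le_of_lt hs)
      rw [(h.iterDeriv _).eq_of_nhds, iterDeriv_const]; rfl
  have hb : ∀ l : List ℝ, ∃ C, ∀ t, |iterDeriv (l ++ [1]) Real.smoothTransition t| ≤ C := by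
    intro l
    refine Continuous.bounded_above_of_compact_support
      (contDiff_iterDeriv hρ _).continuous ?_
    exact HasCompactSupport.intro (isCompact_Icc (a := (0 : ℝ)) (b := 1)) (hz l)
  obtain ⟨C₁, h₁⟩ := hb []
  obtain ⟨C₂, h₂⟩ := hb [1]
  refine ⟨Real.smoothTransition, max C₁ C₂, hρ, fun t => ?_,
    fun t ht => Real.smoothTransition.zero_of_nonpos ht,
    fun t ht => Real.smoothTransition.one_of_one_le ht, ?_,
    fun t => (h₁ t).trans (le_max_left _ _), fun t => (h₂ t).trans (le_max_right _ _),
    fun t ht => ⟨hz [] t ht, hz [1] t ht⟩⟩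
  · rw [abs_of_nonneg (Real.smoothTransition.nonneg t)]
    exact Real.smoothTransition.le_one t
  · exact (abs_nonneg _).trans ((h₁ 0).trans (le_max_left _ _))

/-! ### The terms of the norm in logarithmic coordinates, and abstract cutoffs -/

namespace WeightedSobolev

/-- The terms of the norm of `W^{2,p}_𝒩(α₁, α₂, m)`: the function itself, `D_{x_i}`,
`D_{x_i x_j}`, `D_y` with the weight `y ^ (α₂ / 2)`, `D_y` with the weight `y ^ (α₂ - 1)` and
`D_{yy}`. -/
inductive Term (N : ℕ)
  | val
  | dx (i : Fin N)
  | dxx (i j : Fin N)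
  | dy
  | dyN
  | dyy

variable {N : ℕ}

instance : Finite (Term N) := by
  let f : (Fin N ⊕ Fin N × Fin N) ⊕ Fin 4 → Term N := fun x =>
    match x with
    | .inl (.inl i) => .dx i
    | .inl (.inr (i, j)) => .dxx i j
    | .inr 0 => .val
    | .inr 1 => .dy
    | .inr 2 => .dyN
    | .inr 3 => .dyy
  refine Finite.of_surjective f fun k => ?_
  match k with
  | .dx i => exact ⟨.inl (.inl i), rfl⟩
  | .dxx i j => exact ⟨.inl (.inr (i, j)), rfl⟩
  | .val => exact ⟨.inr 0, rfl⟩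
  | .dy => exact ⟨.inr 1, rfl⟩
  | .dyN => exact ⟨.inr 2, rfl⟩
  | .dyy => exact ⟨.inr 3, rfl⟩

/-- The directions of differentiation of a term. -/
def Term.word : Term N → List (Space N)
  | .val => []
  | .dx i => [dir N (some i)]
  | .dxx i j => [dir N (some i), dir N (some j)]
  | .dy => [dir N none]
  | .dyN => [dir N none]
  | .dyy => [dir N none, dir N none]

/-- The exponent `a` of the weight `exp (a s)` of a term in the coordinates `(x, s)`, `y = exp s`,
where `c = (m + 1) / p`: the factor `y ^ m dy` contributes `c`, and each `D_y` replaced by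
`D_s = y D_y` contributes `-1`. -/
def Term.logExponent (c α₁ α₂ : ℝ) : Term N → ℝ
  | .val => c
  | .dx _ => c + α₁ / 2
  | .dxx _ _ => c + α₁
  | .dy => c + α₂ / 2 - 1
  | .dyN => c + α₂ - 2
  | .dyy => c + α₂ - 2

variable {F : Type*} [NormedAddCommGroup F] [NormedSpace ℝ F]

/-- The function `exp (a s) g (x, s)`. -/
def expWeight (a : ℝ) (g : Space N → F) : Space N → F := fun z => Real.exp (a * z.2) • g z

theorem continuous_expWeight (a : ℝ) {g : Space N → F} (hg : Continuous g) :
    Continuous (expWeight a g) := by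
  unfold expWeight; fun_prop

theorem expWeight_add (a : ℝ) (g h : Space N → F) :
    expWeight a (g + h) = expWeight a g + expWeight a h := by
  funext z; simp [expWeight]

theorem expWeight_sub (a : ℝ) (g h : Space N → F) :
    expWeight a (g - h) = expWeight a g - expWeight a h := by
  funext z; simp [expWeight, smul_sub]

/-- Smooth functions for which all the terms of the norm, in the coordinates `(x, s)`, are
in `L^p`. -/
structure MemLog (p : ℝ≥0∞) (c α₁ α₂ : ℝ) (u : Space N → F) : Prop where
  contDiff : ContDiff ℝ ∞ u
  memLp : ∀ k : Term N, MemLp (expWeight (k.logExponent c α₁ α₂) (iterDeriv k.word u)) p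

variable {p : ℝ≥0∞} {c α₁ α₂ : ℝ}

/-- Bounded sequences of smooth functions `ζ n` whose supports escape to infinity; multiplication by
`1 - ζ n` cuts off a neighbourhood of infinity. -/
structure IsCutoff (ζ : ℕ → Space N → ℝ) : Prop where
  contDiff : ∀ n, ContDiff ℝ ∞ (ζ n)
  abs_le : ∀ n z, |ζ n z| ≤ 1
  eventuallyEq : ∀ z, ∀ᶠ n in atTop, ζ n =ᶠ[𝓝 z] fun _ => 0

theorem IsCutoff.eventually_iterDeriv {ζ : ℕ → Space N → ℝ} (hζ : IsCutoff ζ)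
    (l : List (Space N)) (z : Space N) : ∀ᶠ n in atTop, iterDeriv l (ζ n) z = 0 := by
  filter_upwards [hζ.eventuallyEq z] with n hn
  rw [(hn.iterDeriv l).eq_of_nhds, show (fun _ : Space N => (0 : ℝ)) = 0 from rfl, iterDeriv_zero]
  rfl

/-- Dominated convergence for the products of `g` with coefficients `c n` that vanish eventually
at each point, when on the support of `g` the weights with the exponents `a` and `b` can be compared. -/
theorem tendsto_expWeight_smul_of_le (hp : p ≠ ⊤) {a b C : ℝ}
    {c : ℕ → Space N → ℝ} {g : Space N → F}
    (hc : ∀ n, Continuous (c n)) (hg : Continuous g) (hb : MemLp (expWeight b g) p)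
    (hle : ∀ n z, g z ≠ 0 → Real.exp (a * z.2) * |c n z| ≤ C * Real.exp (b * z.2))
    (h0 : ∀ z, ∀ᶠ n in atTop, c n z = 0) :
    Tendsto (fun n => eLpNorm (expWeight a fun z => c n z • g z) p volume) atTop (𝓝 0) := by
  refine tendsto_eLpNorm_zero_of_dominated hp (G := fun z => C * ‖expWeight b g z‖)
    (fun n => (continuous_expWeight a ((hc n).smul hg)).aestronglyMeasurable)
    (hb.norm.const_mul C) (fun n z => ?_) fun z => ?_
  · simp only [expWeight, norm_smul, Real.norm_eq_abs, Real.abs_exp]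
    by_cases hz : g z = 0
    · simp [hz]
    · have := hle n z hz
      rw [← mul_assoc, ← mul_assoc]
      gcongr
  · refine tendsto_const_nhds.congr' ?_
    filter_upwards [h0 z] with n hn
    simp [expWeight, hn]

theorem tendsto_expWeight_add (hp1 : 1 ≤ p) {a : ℝ} {g h : ℕ → Space N → F}
    (hg : ∀ n, Continuous (g n)) (hh : ∀ n, Continuous (h n))
    (hg0 : Tendsto (fun n => eLpNorm (expWeight a (g n)) p volume) atTop (𝓝 0))
    (hh0 : Tendsto (fun n => eLpNorm (expWeight a (h n)) p volume) atTop (𝓝 0)) :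
    Tendsto (fun n => eLpNorm (expWeight a fun z => g n z + h n z) p volume) atTop (𝓝 0) := by
  have h2 := hg0.add hh0
  rw [add_zero] at h2
  refine tendsto_of_tendsto_of_tendsto_of_le_of_le tendsto_const_nhds h2 (fun _ => zero_le)
    fun n => ?_
  change eLpNorm (expWeight a (g n + h n)) p volume ≤ _
  rw [expWeight_add]
  exact eLpNorm_add_le (continuous_expWeight a (hg n)).aestronglyMeasurable
    (continuous_expWeight a (hh n)).aestronglyMeasurable hp1

/-- The terms of `ζ n • u` tend to zero as soon as the commutators of the derivatives with the
cutoff do: the remaining part `ζ n • D u` tends to zero by dominated convergence. -/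
theorem IsCutoff.tendsto_of_commutators (hp1 : 1 ≤ p) (hp : p ≠ ⊤) {ζ : ℕ → Space N → ℝ}
    (hζ : IsCutoff ζ) {u : Space N → F} (hu : MemLog p c α₁ α₂ u)
    (h1 : ∀ k : Term N, ∀ v, k.word = [v] → Tendsto (fun n => eLpNorm
      (expWeight (k.logExponent c α₁ α₂) fun z => iterDeriv [v] (ζ n) z • u z) p volume)
      atTop (𝓝 0))
    (h2 : ∀ k : Term N, ∀ v w, k.word = [v, w] → ∀ v' ∈ [v, w], ∀ w' ∈ [v, w],
      Tendsto (fun n => eLpNorm (expWeight (k.logExponent c α₁ α₂)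
        fun z => iterDeriv [v'] (ζ n) z • iterDeriv [w'] u z) p volume) atTop (𝓝 0))
    (h3 : ∀ k : Term N, ∀ v w, k.word = [v, w] → Tendsto (fun n => eLpNorm
      (expWeight (k.logExponent c α₁ α₂) fun z => iterDeriv [v, w] (ζ n) z • u z) p volume)
      atTop (𝓝 0)) (k : Term N) :
    Tendsto (fun n => eLpNorm (expWeight (k.logExponent c α₁ α₂)
      (iterDeriv k.word fun z => ζ n z • u z)) p volume) atTop (𝓝 0) := by
  have hc1 : ∀ (l l' : List (Space N)) n,
      Continuous fun z => iterDeriv l (ζ n) z • iterDeriv l' u z := fun l l' n => (contDiff_iterDeriv (hζ.contDiff n) l).continuous.smul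
      (contDiff_iterDeriv hu.contDiff l').continuous
  have main : Tendsto (fun n => eLpNorm (expWeight (k.logExponent c α₁ α₂)
      fun z => ζ n z • iterDeriv k.word u z) p volume) atTop (𝓝 0) := by
    refine tendsto_expWeight_smul_of_le hp (C := 1) (fun n => (hζ.contDiff n).continuous)
      (contDiff_iterDeriv hu.contDiff _).continuous (hu.memLp k) (fun n z _ => ?_)
      (hζ.eventually_iterDeriv [])
    rw [mul_comm]
    exact mul_le_mul_of_nonneg_right (hζ.abs_le n z) (Real.exp_nonneg _)
  have one : ∀ v, k.word = [v] → Tendsto (fun n => eLpNorm (expWeight (k.logExponent c α₁ α₂)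
      (iterDeriv k.word fun z => ζ n z • u z)) p volume) atTop (𝓝 0) := by
    intro v hv
    have := tendsto_expWeight_add hp1 (hc1 [] k.word) (hc1 [v] []) main (h1 k v hv)
    refine this.congr fun n => ?_
    rw [hv, iterDeriv_singleton_smul (hζ.contDiff n) hu.contDiff]
    rfl
  have two : ∀ v w, k.word = [v, w] → Tendsto (fun n => eLpNorm
      (expWeight (k.logExponent c α₁ α₂)
      (iterDeriv k.word fun z => ζ n z • u z)) p volume) atTop (𝓝 0) := by
    intro v w hv
    have := tendsto_expWeight_add hp1
      (fun n => (hc1 [] k.word n).add (hc1 [v] [w] n))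
      (fun n => (hc1 [w] [v] n).add (hc1 [v, w] [] n))
      (tendsto_expWeight_add hp1 (hc1 [] k.word) (hc1 [v] [w]) main
        (h2 k v w hv v (by simp) w (by simp)))
      (tendsto_expWeight_add hp1 (hc1 [w] [v]) (hc1 [v, w] [])
        (h2 k v w hv w (by simp) v (by simp)) (h3 k v w hv))
    refine this.congr fun n => ?_
    rw [hv, iterDeriv_pair_smul (hζ.contDiff n) hu.contDiff]
    rfl
  match k with
  | .val => exact main
  | .dx i => exact one _ rfl
  | .dxx i j => exact two _ _ rfl
  | .dy => exact one _ rfl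
  | .dyN => exact one _ rfl
  | .dyy => exact two _ _ rfl

/-- Cutting off in the sense of `IsCutoff` gives approximations if the terms of `ζ n • u` tend to
zero. -/
theorem IsCutoff.exists_memLog {ζ : ℕ → Space N → ℝ}
    (hζ : IsCutoff ζ) {u : Space N → F} (hu : MemLog p c α₁ α₂ u)
    (h : ∀ k : Term N, Tendsto (fun n => eLpNorm (expWeight (k.logExponent c α₁ α₂)
      (iterDeriv k.word fun z => ζ n z • u z)) p volume) atTop (𝓝 0))
    {η : ℝ≥0∞} (hη : 0 < η) (hη' : η ≠ ⊤) :
    ∃ n, MemLog p c α₁ α₂ (fun z => u z - ζ n z • u z) ∧ ∀ k : Term N,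
      eLpNorm (expWeight (k.logExponent c α₁ α₂)
        (iterDeriv k.word u - iterDeriv k.word fun z => u z - ζ n z • u z)) p volume ≤ η := by
  obtain ⟨n, hn⟩ := (eventually_all.2 fun k => (h k).eventually
    (ge_mem_nhds hη : ∀ᶠ x in 𝓝 (0 : ℝ≥0∞), x ≤ η)).exists
  have hs : ContDiff ℝ ∞ fun z => ζ n z • u z := (hζ.contDiff n).smul hu.contDiff
  have e : ∀ k : Term N, (iterDeriv k.word fun z => u z - ζ n z • u z) =
      iterDeriv k.word u - iterDeriv k.word fun z => ζ n z • u z := fun k =>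
    iterDeriv_sub hu.contDiff hs k.word
  refine ⟨n, ⟨hu.contDiff.sub hs, fun k => ?_⟩, fun k => ?_⟩
  · rw [e k, expWeight_sub]
    exact (hu.memLp k).sub ⟨(continuous_expWeight _
      (contDiff_iterDeriv hs _).continuous).aestronglyMeasurable,
      (hn k).trans_lt hη'.lt_top⟩
  · rw [e k, sub_sub_cancel]
    exact hn k

end WeightedSobolev

/-! ### Cutting off in the normal variable -/

namespace WeightedSobolev

variable {N : ℕ} {F : Type*} [NormedAddCommGroup F] [NormedSpace ℝ F]
variable {p : ℝ≥0∞} {c α₁ α₂ : ℝ}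

theorem contDiff_comp_snd_affine {ρ : ℝ → ℝ} (hρ : ContDiff ℝ ∞ ρ) (r b : ℝ) :
    ContDiff ℝ ∞ fun z : Space N => ρ (r * z.2 + b) := by fun_prop

theorem iterDeriv_comp_snd_affine {ρ : ℝ → ℝ} (hρ : ContDiff ℝ ∞ ρ) (r b : ℝ)
    (l : List (Space N)) :
    iterDeriv l (fun z : Space N => ρ (r * z.2 + b)) =
      fun z => r ^ l.length * iterDeriv (l.map Prod.snd) ρ (r * z.2 + b) := by
  have h := iterDeriv_comp_clm_add hρ
    (r • ContinuousLinearMap.snd ℝ (EuclideanSpace ℝ (Fin N)) ℝ) b l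
  have e : l.map (r • ContinuousLinearMap.snd ℝ (EuclideanSpace ℝ (Fin N)) ℝ) =
      (l.map Prod.snd).map (r • ·) := by
    rw [List.map_map]; rfl
  rw [e, iterDeriv_map_smul r hρ] at h
  simpa using h

/-- For a cutoff that depends on `s` only, which commutes with the derivatives in `x`, it is enough
to control the commutators of the derivatives in `s`. Their weights have exponents between
`c + α₂ - 2` and the larger one of `c + α₂ / 2 - 1` and `c + α₂ - 2`. -/
theorem IsCutoff.tendsto_of_snd (hp1 : 1 ≤ p) (hp : p ≠ ⊤) {ρ : ℝ → ℝ} {C : ℝ}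
    (hρ : ContDiff ℝ ∞ ρ) (hC : ∀ t, |iterDeriv [1] ρ t| ≤ C) {r b : ℕ → ℝ}
    (hr : ∀ n, |r n| ≤ 1)
    (hζ : IsCutoff fun n (z : Space N) => ρ (r n * z.2 + b n)) {u : Space N → F}
    (hu : MemLog p c α₁ α₂ u)
    (h1 : ∀ a, c + α₂ - 2 ≤ a → a ≤ max (c + α₂ / 2 - 1) (c + α₂ - 2) →
      Tendsto (fun n => eLpNorm (expWeight a fun z : Space N =>
      (r n * iterDeriv [1] ρ (r n * z.2 + b n)) • u z) p volume) atTop (𝓝 0))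
    (h2 : Tendsto (fun n => eLpNorm (expWeight (c + α₂ - 2) fun z : Space N =>
      (r n ^ 2 * iterDeriv [1, 1] ρ (r n * z.2 + b n)) • u z) p volume) atTop (𝓝 0))
    (hα : α₂ < 2) (k : Term N) :
    Tendsto (fun n => eLpNorm (expWeight (k.logExponent c α₁ α₂)
      (iterDeriv k.word fun z => ρ (r n * z.2 + b n) • u z)) p volume) atTop (𝓝 0) := by
  have hx : ∀ i n, iterDeriv [dir N (some i)] (fun z : Space N => ρ (r n * z.2 + b n)) = 0 := by
    intro i n
    rw [iterDeriv_comp_snd_affine hρ]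
    funext z
    simp [dir, iterDeriv]
  have hxx : ∀ i j n, iterDeriv [dir N (some i), dir N (some j)]
      (fun z : Space N => ρ (r n * z.2 + b n)) = 0 := by
    intro i j n
    rw [iterDeriv_comp_snd_affine hρ]
    funext z
    simp [dir, iterDeriv]
  have hy : ∀ n, iterDeriv [dir N none] (fun z : Space N => ρ (r n * z.2 + b n)) =
      fun z => r n * iterDeriv [1] ρ (r n * z.2 + b n) := by
    intro n
    rw [iterDeriv_comp_snd_affine hρ]
    simp [dir]
  have hyy : ∀ n, iterDeriv [dir N none, dir N none] (fun z : Space N => ρ (r n * z.2 + b n)) =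
      fun z => r n ^ 2 * iterDeriv [1, 1] ρ (r n * z.2 + b n) := by
    intro n
    rw [iterDeriv_comp_snd_affine hρ]
    simp [dir]
  have hzero : ∀ a, eLpNorm (expWeight a fun _ : Space N => (0 : F)) p volume = 0 := by
    intro a
    have : (expWeight a fun _ : Space N => (0 : F)) = 0 := by funext z; simp [expWeight]
    rw [this, eLpNorm_zero]
  refine hζ.tendsto_of_commutators hp1 hp hu ?_ ?_ ?_ k
  · rintro (_ | i | ⟨i, j⟩ | _ | _ | _) v hv <;> simp only [Term.word, List.cons.injEq, and_true,
      reduceCtorEq, and_false] at hv <;> subst hv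
    · simp [hx, hzero]
    · simp only [hy]
      exact h1 _ (by simp only [Term.logExponent]; linarith) (le_max_left _ _)
    · simp only [hy]
      exact h1 _ le_rfl (le_max_right _ _)
  · rintro (_ | i | ⟨i, j⟩ | _ | _ | _) v w hv v' hv' w' hw' <;>
      simp only [Term.word, List.cons.injEq, and_true,
      reduceCtorEq, and_false] at hv <;> obtain ⟨rfl, rfl⟩ := hv
    · have : ∀ n, iterDeriv [v'] (fun z : Space N => ρ (r n * z.2 + b n)) = 0 := by
        intro n
        rcases List.mem_pair.1 hv' with rfl | rfl
        · exact hx i n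
        · exact hx j n
      simp [this, hzero]
    · obtain rfl : v' = dir N none := by simpa using hv'
      obtain rfl : w' = dir N none := by simpa using hw'
      refine tendsto_expWeight_smul_of_le (C := C) hp
        (fun n => (contDiff_iterDeriv (hζ.contDiff n) [dir N none]).continuous)
        (contDiff_iterDeriv hu.contDiff [dir N none]).continuous (hu.memLp .dyN)
        (fun n z _ => ?_) (hζ.eventually_iterDeriv _)
      rw [hy, mul_comm, abs_mul]
      have : |r n| * |iterDeriv [1] ρ (r n * z.2 + b n)| ≤ 1 * C :=
        mul_le_mul (hr n) (hC _) (abs_nonneg _) zero_le_one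
      rw [one_mul] at this
      exact mul_le_mul_of_nonneg_right this (Real.exp_nonneg _)
  · rintro (_ | i | ⟨i, j⟩ | _ | _ | _) v w hv <;>
      simp only [Term.word, List.cons.injEq, and_true,
      reduceCtorEq, and_false] at hv <;> obtain ⟨rfl, rfl⟩ := hv
    · simp [hxx, hzero]
    · simp only [hyy]
      exact h2

/-- Approximation by functions that vanish for large `s`. The commutators live where `s ≥ 0`, and
there the exponents of the derivatives in `s`, which are at most `c`, give weights at most that of
`u`. -/
theorem MemLog.exists_vanishing_top (hp1 : 1 ≤ p) (hp : p ≠ ⊤) (hα : α₂ < 2)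
    {u : Space N → F} (hu : MemLog p c α₁ α₂ u) {η : ℝ≥0∞} (hη : 0 < η) (hη' : η ≠ ⊤) :
    ∃ v : Space N → F, MemLog p c α₁ α₂ v ∧ (∃ S, 0 ≤ S ∧ ∀ x s, S ≤ s → v (x, s) = 0) ∧
      ∀ k : Term N, eLpNorm (expWeight (k.logExponent c α₁ α₂)
        (iterDeriv k.word u - iterDeriv k.word v)) p volume ≤ η := by
  obtain ⟨ρ, C, hρ, hρ1, hρl, hρr, hC0, hC1, hC2, hρs⟩ := exists_smooth_step
  have hev : ∀ z : Space N, ∀ᶠ n : ℕ in atTop, z.2 < n := fun z =>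
    (tendsto_natCast_atTop_atTop (R := ℝ)).eventually_gt_atTop z.2
  have hζ : IsCutoff fun (n : ℕ) (z : Space N) => ρ ((fun _ => 1 : ℕ → ℝ) n * z.2
      + (fun n => -n : ℕ → ℝ) n) := by
    refine ⟨fun n => contDiff_comp_snd_affine hρ _ _, fun n z => hρ1 _, fun z => ?_⟩
    filter_upwards [hev z] with n hn
    have : {w : Space N | w.2 < n} ∈ 𝓝 z :=
      (isOpen_lt continuous_snd continuous_const).mem_nhds hn
    filter_upwards [this] with w hw
    refine hρl _ ?_
    have hw' : w.2 < n := hw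
    linarith
  have hD : ∀ (l : List ℝ) (a : ℝ), a ≤ c →
      (∀ t, |iterDeriv (l ++ [1]) ρ t| ≤ C) →
      (∀ t, t ∉ Icc (0 : ℝ) 1 → iterDeriv (l ++ [1]) ρ t = 0) →
      Tendsto (fun n : ℕ => eLpNorm (expWeight a fun z : Space N =>
        (iterDeriv (l ++ [1]) ρ (z.2 - n)) • u z) p volume) atTop (𝓝 0) := by
    intro l a ha hb h0
    refine tendsto_expWeight_smul_of_le (C := C) (b := c) hp
      (fun n => (contDiff_iterDeriv hρ _).continuous.comp (by fun_prop))
      hu.contDiff.continuous (hu.memLp .val) (fun n z _ => ?_) fun z => ?_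
    · by_cases hz : z.2 - n ∈ Icc (0 : ℝ) 1
      · have hz0 : 0 ≤ z.2 := by
          have := hz.1
          have := n.cast_nonneg (α := ℝ)
          linarith
        rw [mul_comm]
        exact mul_le_mul (hb _) (Real.exp_le_exp.2 (mul_le_mul_of_nonneg_right ha hz0))
          (Real.exp_nonneg _) hC0
      · rw [h0 _ hz]
        simp only [abs_zero, mul_zero]; positivity
    · filter_upwards [hev z] with n hn
      refine h0 _ fun h => ?_
      have := h.1
      linarith
  obtain ⟨n, hn, hn'⟩ := hζ.exists_memLog hu
    (hζ.tendsto_of_snd hp1 hp hρ hC1 (by simp) hu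
      (fun a _ ha => by
        simpa [sub_eq_add_neg] using
          hD [] a (ha.trans (max_le (by linarith) (by linarith))) hC1 fun t ht => (hρs t ht).1)
      (by simpa [sub_eq_add_neg] using
          hD [1] (c + α₂ - 2) (by linarith) hC2 fun t ht => (hρs t ht).2) hα) hη hη'
  refine ⟨_, hn, ⟨n + 1, by positivity, fun x s hs => ?_⟩, hn'⟩
  simp only
  rw [hρr _ (by linarith), one_smul, sub_self]

theorem hasDerivAt_snd {u : Space N → F} (hu : ContDiff ℝ ∞ u) (x : EuclideanSpace ℝ (Fin N))
    (s : ℝ) : HasDerivAt (fun s => u (x, s)) (iterDeriv [dir N none] u (x, s)) s := by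
  have h1 : HasDerivAt (fun s : ℝ => (x, s)) ((0 : EuclideanSpace ℝ (Fin N)), (1 : ℝ)) s :=
    (hasDerivAt_const s x).prodMk (hasDerivAt_id s)
  exact (hu.differentiable (by simp) (x, s)).hasFDerivAt.comp_hasDerivAt s h1

/-- Approximation of functions that vanish for large `s` by functions that vanish for large `|s|`.
The step is done at the scale `n` near `s = -n`, and `tendsto_eLpNorm_strip` controls the
commutators. -/
theorem MemLog.exists_vanishing_bot [CompleteSpace F] (hp1 : 1 < p) (hp : p ≠ ⊤) (hα : α₂ < 2)
    (hc : 2 - α₂ ≤ c) {u : Space N → F} (hu : MemLog p c α₁ α₂ u)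
    {S : ℝ} (hS : 0 ≤ S) (huS : ∀ x s, S ≤ s → u (x, s) = 0)
    {η : ℝ≥0∞} (hη : 0 < η) (hη' : η ≠ ⊤) :
    ∃ v : Space N → F, MemLog p c α₁ α₂ v ∧ (∃ T, 0 ≤ T ∧ ∀ x s, T ≤ |s| → v (x, s) = 0) ∧
      ∀ k : Term N, eLpNorm (expWeight (k.logExponent c α₁ α₂)
        (iterDeriv k.word u - iterDeriv k.word v)) p volume ≤ η := by
  obtain ⟨ρ, C, hρ, hρ1, hρl, hρr, hC0, hC1, hC2, hρs⟩ := exists_smooth_step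
  have hζ : IsCutoff fun (n : ℕ) (z : Space N) => ρ ((fun n => -((n : ℝ) + 1)⁻¹ : ℕ → ℝ) n * z.2
      + (fun _ => -1 : ℕ → ℝ) n) := by
    refine ⟨fun n => contDiff_comp_snd_affine hρ _ _, fun n z => hρ1 _, fun z => ?_⟩
    filter_upwards [(tendsto_natCast_atTop_atTop (R := ℝ)).eventually_gt_atTop (-z.2)] with n hn
    have : {w : Space N | -w.2 < n} ∈ 𝓝 z :=
      (isOpen_lt (by fun_prop) continuous_const).mem_nhds hn
    filter_upwards [this] with w hw
    refine hρl _ ?_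
    have hw' : -w.2 < n := hw
    have h2 : ((n : ℝ) + 1)⁻¹ * (-w.2) ≤ 1 := by
      rw [inv_mul_le_iff₀ (by positivity)]; linarith
    linarith
  have hD : ∀ (a : ℝ) (d : ℕ → ℝ → ℝ), c + α₂ - 2 ≤ a →
      (∀ n t, |d n t| ≤ C * ((n : ℝ) + 1)⁻¹) → (∀ n t, t ∉ Icc (0 : ℝ) 1 → d n t = 0) →
      Tendsto (fun n : ℕ => eLpNorm (expWeight a fun z : Space N =>
        (d n (-((n : ℝ) + 1)⁻¹ * z.2 + -1)) • u z) p volume) atTop (𝓝 0) := by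
    intro a d ha hb h0
    have hstrip := tendsto_eLpNorm_strip hp1 hp hu.contDiff.continuous
      (contDiff_iterDeriv hu.contDiff [dir N none]).continuous (hasDerivAt_snd hu.contDiff)
      (b := c + α₂ - 2) (by linarith) hS huS (hu.memLp .dyN)
    have h2 := ENNReal.Tendsto.const_mul (a := ENNReal.ofReal C) hstrip
      (Or.inr ENNReal.ofReal_ne_top)
    rw [mul_zero] at h2
    refine tendsto_of_tendsto_of_tendsto_of_le_of_le tendsto_const_nhds h2 (fun _ => zero_le)
      fun n => eLpNorm_le_mul_eLpNorm_of_ae_le_mul (Eventually.of_forall fun z => ?_) p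
    have hn : (0 : ℝ) < (n : ℝ) + 1 := by positivity
    simp only [expWeight, norm_smul, Real.norm_eq_abs, Real.abs_exp]
    by_cases hz : -((n : ℝ) + 1)⁻¹ * z.2 + -1 ∈ Icc (0 : ℝ) 1
    · have e : -((n : ℝ) + 1)⁻¹ * z.2 = (-z.2) / ((n : ℝ) + 1) := by
        rw [div_eq_inv_mul]; ring
      have hz1 : 1 ≤ (-z.2) / ((n : ℝ) + 1) := by have := hz.1; rw [e] at this; linarith
      have hz2 : (-z.2) / ((n : ℝ) + 1) ≤ 2 := by have := hz.2; rw [e] at this; linarith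
      rw [le_div_iff₀ hn] at hz1
      rw [div_le_iff₀ hn] at hz2
      rw [indicator_of_mem (show z.2 ∈ Icc _ _ from ⟨by linarith, by linarith⟩)]
      rw [abs_of_nonneg (by positivity : 0 ≤ ((n : ℝ) + 1)⁻¹ * Real.exp ((c + α₂ - 2) * z.2)),
        ← mul_assoc, ← mul_assoc, ← mul_assoc, mul_comm (Real.exp _)]
      have hexp : Real.exp (a * z.2) ≤ Real.exp ((c + α₂ - 2) * z.2) :=
        Real.exp_le_exp.2 (mul_le_mul_of_nonpos_right ha (by linarith))
      have := hb n (-((n : ℝ) + 1)⁻¹ * z.2 + -1)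
      gcongr
    · rw [h0 _ _ hz]
      simp only [abs_zero, zero_mul, mul_zero]; positivity
  have hr : ∀ n : ℕ, |-((n : ℝ) + 1)⁻¹| ≤ 1 := fun n => by
    rw [abs_neg, abs_of_nonneg (by positivity)]
    exact inv_le_one_of_one_le₀ (by have := n.cast_nonneg (α := ℝ); linarith)
  obtain ⟨n, hn, hn'⟩ := hζ.exists_memLog hu
    (hζ.tendsto_of_snd hp1.le hp hρ hC1 hr hu
      (fun a ha _ => by
        refine hD a (fun n t => -((n : ℝ) + 1)⁻¹ * iterDeriv [1] ρ t) ha (fun n t => ?_)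
          fun n t ht => by rw [(hρs t ht).1, mul_zero]
        rw [abs_mul, mul_comm, abs_neg, abs_of_nonneg (by positivity : 0 ≤ ((n : ℝ) + 1)⁻¹)]
        gcongr
        exact hC1 t)
      (by
        refine hD _ (fun n t => (-((n : ℝ) + 1)⁻¹) ^ 2 * iterDeriv [1, 1] ρ t) le_rfl
          (fun n t => ?_) fun n t ht => by rw [(hρs t ht).2, mul_zero]
        rw [abs_mul, mul_comm, abs_pow, pow_two, ← mul_assoc]
        calc _ ≤ C * ((n : ℝ) + 1)⁻¹ * 1 := by
              gcongr
              · exact hC2 t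
              · rw [abs_neg, abs_of_nonneg (by positivity)]
              · exact hr n
          _ = _ := mul_one _) hα) hη hη'
  refine ⟨_, hn, ⟨max S (2 * (n + 1)), le_max_of_le_left hS, fun x s hs => ?_⟩, hn'⟩
  rcases le_abs.1 (le_refl |s|) with h | h
  · simp [huS x s ((le_max_left _ _).trans (hs.trans h))]
  · have h2 : 2 * ((n : ℝ) + 1) ≤ -s := (le_max_right _ _).trans (hs.trans h)
    simp only
    rw [hρr, one_smul, sub_self]
    have : 2 ≤ ((n : ℝ) + 1)⁻¹ * (-s) := by
      rw [inv_mul_eq_div, le_div_iff₀ (by positivity)]; exact h2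
    linarith

end WeightedSobolev

/-! ### Cutting off in the tangential variables -/

namespace WeightedSobolev

variable {N : ℕ} {F : Type*} [NormedAddCommGroup F] [NormedSpace ℝ F]
variable {p : ℝ≥0∞} {c α₁ α₂ : ℝ}

theorem iterDeriv_comp_smul_fst {χ : EuclideanSpace ℝ (Fin N) → ℝ} (hχ : ContDiff ℝ ∞ χ) (r : ℝ)
    (l : List (Space N)) :
    iterDeriv l (fun z : Space N => χ (r • z.1)) =
      fun z => r ^ l.length * iterDeriv (l.map Prod.fst) χ (r • z.1) := by
  have h := iterDeriv_comp_clm_add hχ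
    (r • ContinuousLinearMap.fst ℝ (EuclideanSpace ℝ (Fin N)) ℝ) 0 l
  have e : l.map (r • ContinuousLinearMap.fst ℝ (EuclideanSpace ℝ (Fin N)) ℝ) =
      (l.map Prod.fst).map (r • ·) := by
    rw [List.map_map]; rfl
  rw [e, iterDeriv_map_smul r hχ] at h
  simpa using h

theorem exp_le_of_abs_le {a b s T : ℝ} (hs : |s| ≤ T) :
    Real.exp (a * s) ≤ Real.exp (|a - b| * T) * Real.exp (b * s) := by
  rw [← Real.exp_add, Real.exp_le_exp]
  have : (a - b) * s ≤ |a - b| * T :=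
    (le_abs_self _).trans (by rw [abs_mul]; gcongr)
  linarith

/-- Approximation of functions that vanish for large `|s|` by functions with compact support. -/
theorem MemLog.exists_hasCompactSupport_of_vanishing (hp1 : 1 ≤ p) (hp : p ≠ ⊤)
    {u : Space N → F} (hu : MemLog p c α₁ α₂ u)
    {T : ℝ} (huT : ∀ x s, T ≤ |s| → u (x, s) = 0)
    {η : ℝ≥0∞} (hη : 0 < η) (hη' : η ≠ ⊤) :
    ∃ v : Space N → F, MemLog p c α₁ α₂ v ∧ HasCompactSupport v ∧
      ∀ k : Term N, eLpNorm (expWeight (k.logExponent c α₁ α₂)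
        (iterDeriv k.word u - iterDeriv k.word v)) p volume ≤ η := by
  let χ : ContDiffBump (0 : EuclideanSpace ℝ (Fin N)) := ⟨1, 2, by norm_num, by norm_num⟩
  have hχ : ContDiff ℝ ∞ fun x => 1 - χ x := contDiff_const.sub χ.contDiff
  set r : ℕ → ℝ := fun n => ((n : ℝ) + 1)⁻¹ with hr
  have hr0 : ∀ n, 0 ≤ r n := fun n => by positivity
  have hr1 : ∀ n, r n ≤ 1 := fun n =>
    inv_le_one_of_one_le₀ (by have := n.cast_nonneg (α := ℝ); linarith)
  have hζ : IsCutoff fun (n : ℕ) (z : Space N) => 1 - χ (r n • z.1) := by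
    refine ⟨fun n => hχ.comp (contDiff_fst.const_smul (r n)), fun n z => ?_, fun z => ?_⟩
    · rw [abs_of_nonneg (sub_nonneg.2 χ.le_one)]
      exact sub_le_self _ χ.nonneg
    · filter_upwards [(tendsto_natCast_atTop_atTop (R := ℝ)).eventually_gt_atTop ‖z.1‖] with n hn
      have : {w : Space N | ‖w.1‖ < n} ∈ 𝓝 z :=
        (isOpen_lt (by fun_prop) continuous_const).mem_nhds hn
      filter_upwards [this] with w hw
      have hw' : ‖w.1‖ < n := hw
      rw [χ.one_of_mem_closedBall, sub_self]
      rw [mem_closedBall_zero_iff, norm_smul, Real.norm_of_nonneg (hr0 n)]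
      change ((n : ℝ) + 1)⁻¹ * _ ≤ 1
      rw [inv_mul_le_iff₀ (by positivity)]; linarith
  have hbound : ∀ (l : List (EuclideanSpace ℝ (Fin N))) w,
      ∃ C, 0 ≤ C ∧ ∀ x, |iterDeriv (l ++ [w]) (fun x => 1 - χ x) x| ≤ C := by
    intro l w
    obtain ⟨C, hC⟩ := Continuous.bounded_above_of_compact_support
      (contDiff_iterDeriv (χ.contDiff (n := ⊤)) (l ++ [w])).continuous
      (χ.hasCompactSupport.iterDeriv (l ++ [w]))
    refine ⟨C, (norm_nonneg _).trans (hC 0), fun x => ?_⟩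
    have : iterDeriv (l ++ [w]) (fun x => 1 - χ x) = - iterDeriv (l ++ [w]) χ := by
      have := iterDeriv_sub (f := fun _ : EuclideanSpace ℝ (Fin N) => (1 : ℝ)) (g := χ)
        contDiff_const χ.contDiff (l ++ [w])
      rw [iterDeriv_const, zero_sub] at this
      exact this
    rw [this, Pi.neg_apply, abs_neg]
    exact hC x
  have hpow : ∀ n l, |r n ^ l| ≤ 1 := fun n l => by
    rw [abs_of_nonneg (pow_nonneg (hr0 n) l)]
    exact pow_le_one₀ (hr0 n) (hr1 n)
  have hderiv : ∀ n (l : List (Space N)), iterDeriv l (fun z : Space N => 1 - χ (r n • z.1)) =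
      fun z => r n ^ l.length * iterDeriv (l.map Prod.fst) (fun x => 1 - χ x) (r n • z.1) :=
    fun n l => iterDeriv_comp_smul_fst hχ (r n) l
  have hsupp : ∀ l z, iterDeriv l u z ≠ 0 → |z.2| ≤ T := by
    intro l z hz
    have h1 : z ∈ tsupport u := tsupport_iterDeriv_subset u l (subset_tsupport _ hz)
    have h2 : tsupport u ⊆ {z : Space N | |z.2| ≤ T} := by
      refine closure_minimal (fun w hw => ?_) (isClosed_le (by fun_prop) continuous_const)
      by_contra h
      exact hw (huT w.1 w.2 (le_of_lt (not_le.1 h)))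
    exact h2 h1
  -- a commutator of a derivative in `x`; on the strip `|s| ≤ T` all the weights are equivalent
  have hcomm : ∀ (a b : ℝ) (l : List (Space N)) (w : Space N) (l' : List (Space N)),
      MemLp (expWeight b (iterDeriv l' u)) p →
      Tendsto (fun n => eLpNorm (expWeight a fun z =>
        iterDeriv (l ++ [w]) (fun z : Space N => 1 - χ (r n • z.1)) z • iterDeriv l' u z) p volume)
        atTop (𝓝 0) := by
    intro a b l w l' hb
    obtain ⟨C, hC0, hC⟩ := hbound (l.map Prod.fst) w.1
    refine tendsto_expWeight_smul_of_le (C := C * Real.exp (|a - b| * T)) (b := b) hp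
        (fun n => (contDiff_iterDeriv (hζ.contDiff n) _).continuous)
        (contDiff_iterDeriv hu.contDiff _).continuous hb
        (fun n z hz => ?_) (hζ.eventually_iterDeriv _)
    rw [hderiv, mul_comm, abs_mul, mul_assoc C]
    have h1 : |r n ^ (l ++ [w]).length| *
        |iterDeriv ((l ++ [w]).map Prod.fst) (fun x => 1 - χ x) (r n • z.1)| ≤ 1 * C := by
      rw [List.map_append]
      exact mul_le_mul (hpow _ _) (hC _) (abs_nonneg _) zero_le_one
    rw [one_mul] at h1
    exact mul_le_mul h1 (exp_le_of_abs_le (hsupp l' z hz)) (Real.exp_nonneg _) hC0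
  have hzero : ∀ a, eLpNorm (expWeight a fun _ : Space N => (0 : F)) p volume = 0 := by
    intro a
    have : (expWeight a fun _ : Space N => (0 : F)) = 0 := by funext z; simp [expWeight]
    rw [this, eLpNorm_zero]
  have hy : ∀ n, iterDeriv [dir N none] (fun z : Space N => 1 - χ (r n • z.1)) = 0 := by
    intro n
    rw [hderiv]; funext z; simp [dir, iterDeriv]
  have hyy : ∀ n, iterDeriv [dir N none, dir N none]
      (fun z : Space N => 1 - χ (r n • z.1)) = 0 := by
    intro n
    rw [hderiv]; funext z; simp [dir, iterDeriv]
  obtain ⟨n, hn, hn'⟩ := hζ.exists_memLog hu (hζ.tendsto_of_commutators hp1 hp hu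
    (by
      rintro (_ | i | ⟨i, j⟩ | _ | _ | _) v hv <;> simp only [Term.word, List.cons.injEq, and_true,
        reduceCtorEq, and_false] at hv <;> subst hv
      · exact hcomm _ _ [] _ [] (hu.memLp .val)
      · simp [hy, hzero]
      · simp [hy, hzero])
    (by
      rintro (_ | i | ⟨i, j⟩ | _ | _ | _) v w hv v' hv' w' hw' <;>
        simp only [Term.word, List.cons.injEq, and_true,
        reduceCtorEq, and_false] at hv <;> obtain ⟨rfl, rfl⟩ := hv
      · have : MemLp (expWeight (c + α₁ / 2) (iterDeriv [w'] u)) p := by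
          rcases List.mem_pair.1 hw' with rfl | rfl
          · exact hu.memLp (.dx i)
          · exact hu.memLp (.dx j)
        exact hcomm _ _ [] _ _ this
      · obtain rfl : v' = dir N none := by simpa using hv'
        simp [hy, hzero])
    (by
      rintro (_ | i | ⟨i, j⟩ | _ | _ | _) v w hv <;>
        simp only [Term.word, List.cons.injEq, and_true,
        reduceCtorEq, and_false] at hv <;> obtain ⟨rfl, rfl⟩ := hv
      · exact hcomm _ _ [_] _ [] (hu.memLp .val)
      · simp [hyy, hzero])) hη hη'
  refine ⟨_, hn, HasCompactSupport.intro
    ((isCompact_closedBall (0 : EuclideanSpace ℝ (Fin N)) (2 * (n + 1))).prod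
      (isCompact_Icc (a := -T) (b := T))) (fun z hz => ?_), hn'⟩
  rw [mem_prod, not_and_or] at hz
  rcases hz with hz | hz
  · rw [χ.zero_of_le_dist, sub_zero, one_smul, sub_self]
    rw [mem_closedBall_zero_iff, not_le] at hz
    rw [dist_zero_right, norm_smul, Real.norm_of_nonneg (hr0 n)]
    change 2 ≤ ((n : ℝ) + 1)⁻¹ * _
    rw [inv_mul_eq_div, le_div_iff₀ (by positivity)]
    exact hz.le
  · have : u z = 0 := by
      refine huT z.1 z.2 ?_
      by_contra h
      exact hz (abs_le.1 (le_of_lt (not_le.1 h)))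
    simp [this]

/-- Approximation by smooth functions with compact support. -/
theorem MemLog.exists_hasCompactSupport [CompleteSpace F] (hp1 : 1 < p) (hp : p ≠ ⊤) (hα : α₂ < 2)
    (hc : 2 - α₂ ≤ c) {u : Space N → F} (hu : MemLog p c α₁ α₂ u)
    {η : ℝ≥0∞} (hη : 0 < η) (hη' : η ≠ ⊤) :
    ∃ v : Space N → F, MemLog p c α₁ α₂ v ∧ HasCompactSupport v ∧
      ∀ k : Term N, eLpNorm (expWeight (k.logExponent c α₁ α₂)
        (iterDeriv k.word u - iterDeriv k.word v)) p volume ≤ η + η + η := by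
  obtain ⟨v₁, h₁, ⟨S, hS, hv₁⟩, e₁⟩ := hu.exists_vanishing_top hp1.le hp hα hη hη'
  obtain ⟨v₂, h₂, ⟨T, _, hv₂⟩, e₂⟩ := h₁.exists_vanishing_bot hp1 hp hα hc hS hv₁ hη hη'
  obtain ⟨v₃, h₃, hv₃, e₃⟩ := h₂.exists_hasCompactSupport_of_vanishing hp1.le hp hv₂ hη hη'
  refine ⟨v₃, h₃, hv₃, fun k => ?_⟩
  have hm : ∀ {v w : Space N → F}, MemLog p c α₁ α₂ v → MemLog p c α₁ α₂ w →
      AEStronglyMeasurable (expWeight (k.logExponent c α₁ α₂)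
        (iterDeriv k.word v - iterDeriv k.word w)) volume := fun hv hw =>
    (continuous_expWeight _ ((contDiff_iterDeriv hv.contDiff _).continuous.sub
      (contDiff_iterDeriv hw.contDiff _).continuous)).aestronglyMeasurable
  have e : iterDeriv k.word u - iterDeriv k.word v₃ =
      (iterDeriv k.word u - iterDeriv k.word v₁) + (iterDeriv k.word v₁ - iterDeriv k.word v₂) +
        (iterDeriv k.word v₂ - iterDeriv k.word v₃) := by abel
  rw [e, expWeight_add, expWeight_add]
  exact (eLpNorm_add_le ((hm hu h₁).add (hm h₁ h₂)) (hm h₂ h₃) hp1.le).trans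
    (add_le_add ((eLpNorm_add_le (hm hu h₁) (hm h₁ h₂) hp1.le).trans (add_le_add (e₁ k) (e₂ k)))
      (e₃ k))

end WeightedSobolev

/-! ### Riemann sums of a convolution -/

namespace WeightedSobolev

section RiemannSum

/-- The coefficients on the right do not depend on `g`. With `g w = K (z - w)` they do not depend on
`z`, and the integral is a combination of translates of `K`. -/
theorem integral_simpleFunc_comp_smul {E F : Type*} [MeasurableSpace E]
    [MeasurableSingletonClass E] {μ : Measure E}
    [NormedAddCommGroup F] [NormedSpace ℝ F] (τ : SimpleFunc E E) (g : E → ℝ) {f : E → F}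
    (hf : Integrable f μ) :
    ∫ w, g (τ w) • f w ∂μ = ∑ q ∈ τ.range, g q • ∫ w in τ ⁻¹' {q}, f w ∂μ := by
  have e : ∀ w, g (τ w) • f w =
      ∑ q ∈ τ.range, indicator (τ ⁻¹' {q}) (fun w => g q • f w) w := by
    intro w
    rw [Finset.sum_eq_single (τ w)]
    · rw [indicator_of_mem (by simp)]
    · intro q _ hq
      exact indicator_of_notMem (fun h => hq (by simpa using h.symm)) _
    · intro h
      exact absurd (τ.mem_range_self w) h
  simp_rw [e]
  rw [integral_finsetSum _ fun q _ =>
    (show Integrable (fun w => g q • f w) μ from hf.smul (g q)).indicator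
      (τ.measurableSet_fiber q)]
  refine Finset.sum_congr rfl fun q _ => ?_
  rw [integral_indicator (τ.measurableSet_fiber q), integral_smul]

variable {E F : Type*} [NormedAddCommGroup E] [NormedSpace ℝ E] [FiniteDimensional ℝ E]
  [MeasurableSpace E] [BorelSpace E] {μ : Measure E} [μ.IsAddHaarMeasure]
  [NormedAddCommGroup F] [NormedSpace ℝ F]

/-- A convolution of smooth functions with compact support is a limit of finite sums of multiples
of translates of the kernel, with all the derivatives: the sums are the Riemann sums of the
convolution integral. -/
theorem exists_riemannSum {K : E → ℝ} (hK : ContDiff ℝ ∞ K) (hKc : HasCompactSupport K)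
    {f : E → F} (hf : ContDiff ℝ ∞ f) (hfc : HasCompactSupport f) :
    ∃ (s : ℕ → Finset E) (c : ℕ → E → F), ∀ (p : ℝ≥0∞) (_ : p ≠ ⊤) (θ : E → ℝ) (_ : Continuous θ)
      (l : List E), Tendsto (fun n => eLpNorm (fun z => θ z •
        (iterDeriv l (fun z => ∑ q ∈ s n, K (z - q) • c n q) z -
          iterDeriv l (K ⋆[ContinuousLinearMap.lsmul ℝ ℝ, μ] f) z)) p μ) atTop (𝓝 0) := by
  obtain ⟨R, hR⟩ : ∃ R, tsupport f ⊆ Metric.closedBall (0 : E) R :=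
    hfc.isBounded.subset_closedBall 0
  obtain ⟨r, hr⟩ : ∃ r, tsupport K ⊆ Metric.closedBall (0 : E) r :=
    hKc.isBounded.subset_closedBall 0
  have hR' : tsupport f ⊆ Metric.closedBall (0 : E) (max R 0) :=
    hR.trans (Metric.closedBall_subset_closedBall (le_max_left _ _))
  set R' := max R 0
  have h0 : (0 : E) ∈ Metric.closedBall (0 : E) R' := by simp [R']
  set τ : ℕ → SimpleFunc E E := fun n =>
    SimpleFunc.approxOn id measurable_id (Metric.closedBall (0 : E) R') 0 h0 n
  have hτmem : ∀ n w, τ n w ∈ Metric.closedBall (0 : E) R' := fun n w =>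
    SimpleFunc.approxOn_mem measurable_id h0 n w
  have hτlim : ∀ w ∈ Metric.closedBall (0 : E) R', Tendsto (fun n => τ n w) atTop (𝓝 w) :=
    fun w hw => SimpleFunc.tendsto_approxOn measurable_id h0 (subset_closure hw)
  have hfi : Integrable f μ := hf.continuous.integrable_of_hasCompactSupport hfc
  have hfz : ∀ w, w ∉ Metric.closedBall (0 : E) R' → f w = 0 := fun w hw =>
    image_eq_zero_of_notMem_tsupport fun h => hw (hR' h)
  refine ⟨fun n => (τ n).range, fun n q => ∫ w in τ n ⁻¹' {q}, f w ∂μ, fun p hp θ hθ l => ?_⟩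
  have hKl := contDiff_iterDeriv hK l
  obtain ⟨M, hM⟩ := Continuous.bounded_above_of_compact_support hKl.continuous (hKc.iterDeriv l)
  have hM0 : 0 ≤ M := (norm_nonneg _).trans (hM 0)
  have hsmooth : ∀ n, ContDiff ℝ ∞ fun z =>
      ∑ q ∈ (τ n).range, K (z - q) • ∫ w in τ n ⁻¹' {q}, f w ∂μ := fun n => by fun_prop
  have hT : ∀ q, ContDiff ℝ ∞ fun z => K (z - q) := fun q => by fun_prop
  have hTc : ∀ n q, ContDiff ℝ ∞ fun z => K (z - q) • ∫ w in τ n ⁻¹' {q}, f w ∂μ :=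
    fun n q => (hT q).smul contDiff_const
  have hconv : ContDiff ℝ ∞ (K ⋆[ContinuousLinearMap.lsmul ℝ ℝ, μ] f) :=
    hKc.contDiff_convolution_left (n := ⊤) _ hK hf.continuous.locallyIntegrable
  have hI : ∀ (n : ℕ) z, Integrable (fun w => iterDeriv l K (z - τ n w) • f w) μ := fun n z => by
    refine hfi.bdd_smul M ?_ (Eventually.of_forall fun w => hM _)
    exact (hKl.continuous.measurable.comp
      (measurable_const.sub (τ n).measurable)).aestronglyMeasurable
  have hI' : ∀ z, Integrable (fun w => iterDeriv l K (z - w) • f w) μ := fun z => by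
    refine hfi.bdd_smul M ?_ (Eventually.of_forall fun w => hM _)
    exact (hKl.continuous.comp (by fun_prop)).aestronglyMeasurable
  have hrep : ∀ n z, iterDeriv l (fun z => ∑ q ∈ (τ n).range, K (z - q) •
      ∫ w in τ n ⁻¹' {q}, f w ∂μ) z - iterDeriv l (K ⋆[ContinuousLinearMap.lsmul ℝ ℝ, μ] f) z =
      ∫ w, (iterDeriv l K (z - τ n w) - iterDeriv l K (z - w)) • f w ∂μ := by
    intro n z
    simp_rw [sub_smul]
    rw [integral_sub (hI n z) (hI' z),
      integral_simpleFunc_comp_smul (τ n) (fun q => iterDeriv l K (z - q)) hfi,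
      iterDeriv_convolution_left hK hKc hf.continuous.locallyIntegrable, convolution_lsmul_swap,
      iterDeriv_sum (hTc n)]
    congr 1
    refine Finset.sum_congr rfl fun q _ => ?_
    rw [iterDeriv_smul_const (hT q), iterDeriv_comp_sub]
  -- all the functions vanish outside this ball, on which `χ = 1`
  let χ : ContDiffBump (0 : E) := ⟨max (r + R') 1, max (r + R') 1 + 1,
    zero_lt_one.trans_le (le_max_right _ _), by linarith⟩
  set B : ℝ := ∫ w, 2 * M * ‖f w‖ ∂μ
  have hB : 0 ≤ B := integral_nonneg fun w => by positivity
  have hKz : ∀ z, z ∉ Metric.closedBall (0 : E) (max (r + R') 1) →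
      ∀ w ∈ Metric.closedBall (0 : E) R', iterDeriv l K (z - w) = 0 := by
    intro z hz w hw
    refine image_eq_zero_of_notMem_tsupport fun h => hz ?_
    have h1 := hr (tsupport_iterDeriv_subset K l h)
    rw [mem_closedBall_zero_iff] at h1 hw ⊢
    calc ‖z‖ = ‖(z - w) + w‖ := by rw [sub_add_cancel]
      _ ≤ r + R' := (norm_add_le _ _).trans (add_le_add h1 hw)
      _ ≤ _ := le_max_left _ _
  refine tendsto_eLpNorm_zero_of_dominated hp (G := fun z => |θ z| * (B * χ z)) (fun n => ?_)
    ?_ (fun n z => ?_) fun z => ?_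
  · exact (hθ.smul ((contDiff_iterDeriv (hsmooth n) l).continuous.sub
      (contDiff_iterDeriv hconv l).continuous)).aestronglyMeasurable
  · refine Continuous.memLp_of_hasCompactSupport
      (hθ.abs.mul (continuous_const.mul χ.continuous)) ?_
    exact (χ.hasCompactSupport.mul_left).mul_left
  · rw [norm_smul, Real.norm_eq_abs, hrep]
    refine mul_le_mul_of_nonneg_left ?_ (abs_nonneg _)
    by_cases hz : z ∈ Metric.closedBall (0 : E) (max (r + R') 1)
    · rw [χ.one_of_mem_closedBall hz, mul_one]
      refine norm_integral_le_of_norm_le (hfi.norm.const_mul _) (Eventually.of_forall fun w => ?_)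
      rw [norm_smul]
      gcongr
      calc _ ≤ _ := norm_sub_le _ _
        _ ≤ M + M := add_le_add (hM _) (hM _)
        _ = 2 * M := by ring
    · have : ∀ w, (iterDeriv l K (z - τ n w) - iterDeriv l K (z - w)) • f w = 0 := by
        intro w
        by_cases hw : w ∈ Metric.closedBall (0 : E) R'
        · rw [hKz z hz w hw, hKz z hz _ (hτmem n w), sub_self, zero_smul]
        · rw [hfz w hw, smul_zero]
      simp_rw [this]
      rw [integral_zero, norm_zero]
      exact mul_nonneg hB χ.nonneg
  · simp_rw [hrep]
    have key : Tendsto (fun n => ∫ w, (iterDeriv l K (z - τ n w) - iterDeriv l K (z - w)) • f w ∂μ)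
        atTop (𝓝 (∫ _, (0 : F) ∂μ)) := by
      refine tendsto_integral_of_dominated_convergence (fun w => 2 * M * ‖f w‖) (fun n => ?_)
        (hfi.norm.const_mul _) (fun n => Eventually.of_forall fun w => ?_)
        (Eventually.of_forall fun w => ?_)
      · simp_rw [sub_smul]
        exact ((hI n z).sub (hI' z)).aestronglyMeasurable
      · rw [norm_smul]
        gcongr
        calc _ ≤ _ := norm_sub_le _ _
          _ ≤ M + M := add_le_add (hM _) (hM _)
          _ = 2 * M := by ring
      · by_cases hw : w ∈ Metric.closedBall (0 : E) R'
        · have h1 : Tendsto (fun n => iterDeriv l K (z - τ n w)) atTop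
              (𝓝 (iterDeriv l K (z - w))) :=
            (hKl.continuous.tendsto _).comp (tendsto_const_nhds.sub (hτlim w hw))
          have h2 := (h1.sub_const (iterDeriv l K (z - w))).smul_const (f w)
          simpa using h2
        · simp [hfz w hw]
    rw [integral_zero] at key
    simpa using key.const_smul (θ z)

end RiemannSum

end WeightedSobolev

/-! ### Density of tensor products in logarithmic coordinates -/

namespace WeightedSobolev

variable {N : ℕ} {F : Type*} [NormedAddCommGroup F] [NormedSpace ℝ F]
variable {p : ℝ≥0∞} {c α₁ α₂ : ℝ}

instance : (volume : Measure (Space N)).IsAddHaarMeasure := by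
  rw [Measure.volume_eq_prod]; infer_instance

/-- Finite sums of functions `f (x) g (s)`, with `f` and `g` smooth and compactly supported; the
values in `F` are carried by constant coefficients. -/
def IsTensor (w : Space N → F) : Prop :=
  ∃ (t : Finset (Space N)) (f : Space N → EuclideanSpace ℝ (Fin N) → ℝ) (g : Space N → ℝ → ℝ)
    (d : Space N → F), (∀ q, ContDiff ℝ ∞ (f q) ∧ HasCompactSupport (f q)) ∧
    (∀ q, ContDiff ℝ ∞ (g q) ∧ HasCompactSupport (g q)) ∧
    w = fun z => ∑ q ∈ t, (f q z.1 * g q z.2) • d q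

theorem IsTensor.contDiff {w : Space N → F} (hw : IsTensor w) : ContDiff ℝ ∞ w := by
  obtain ⟨t, f, g, d, hf, hg, rfl⟩ := hw
  exact ContDiff.sum fun q _ => (((hf q).1.comp contDiff_fst).mul
    ((hg q).1.comp contDiff_snd)).smul contDiff_const

/-- In the coordinates `(x, s)`, mollification with all the weights at once. -/
theorem exists_forall_kernel [CompleteSpace F] (hp1 : 1 ≤ p) (hp : p ≠ ⊤) {u : Space N → F}
    {G : Term N → Space N → F} (hG : ∀ k : Term N, IsIterWeakDeriv volume k.word u (G k))
    (hL : ∀ k : Term N, MemLp (expWeight (k.logExponent c α₁ α₂) (G k)) p)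
    {η : ℝ≥0∞} (hη : 0 < η) :
    ∃ (K₁ : EuclideanSpace ℝ (Fin N) → ℝ) (K₂ : ℝ → ℝ), ContDiff ℝ ∞ K₁ ∧ ContDiff ℝ ∞ K₂ ∧
      HasCompactSupport K₁ ∧ HasCompactSupport K₂ ∧ ∀ k : Term N,
        eLpNorm (expWeight (k.logExponent c α₁ α₂) (iterDeriv k.word
          ((fun z : Space N => K₁ z.1 * K₂ z.2) ⋆[ContinuousLinearMap.lsmul ℝ ℝ, volume] u)
            - G k)) p volume ≤ η := by
  obtain ⟨δ, hδ, h⟩ := exists_eLpNorm_iterDeriv_convolution_sub_le (μ := volume) hp1 hp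
    (L := fun k : Term N => k.logExponent c α₁ α₂ •
      ContinuousLinearMap.snd ℝ (EuclideanSpace ℝ (Fin N)) ℝ) hG hL hη
  obtain ⟨K₁, K₂, h1, h2, hc1, hc2, hpos, hint, hsupp⟩ :=
    exists_product_kernel (X := EuclideanSpace ℝ (Fin N)) (Y := ℝ) hδ
  exact ⟨K₁, K₂, h1, h2, hc1, hc2, fun k => h (fun z => K₁ z.1 * K₂ z.2)
    ((h1.comp contDiff_fst).mul (h2.comp contDiff_snd)) hpos hint hsupp k⟩

theorem hasCompactSupport_mul_prod {X Y : Type*} [TopologicalSpace X] [TopologicalSpace Y]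
    [R1Space X] [R1Space Y] {f : X → ℝ} {g : Y → ℝ}
    (hf : HasCompactSupport f) (hg : HasCompactSupport g) :
    HasCompactSupport fun z : X × Y => f z.1 * g z.2 := by
  refine HasCompactSupport.intro (hf.isCompact.prod hg.isCompact) fun z hz => ?_
  rw [mem_prod, not_and_or] at hz
  rcases hz with hz | hz
  · rw [image_eq_zero_of_notMem_tsupport hz, zero_mul]
  · rw [image_eq_zero_of_notMem_tsupport hz, mul_zero]

/-- Density of the tensor products in the coordinates `(x, s)`. -/
theorem exists_isTensor [CompleteSpace F] (hp1 : 1 < p) (hp : p ≠ ⊤) (hα : α₂ < 2)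
    (hc : 2 - α₂ ≤ c) {u : Space N → F}
    {G : Term N → Space N → F} (hG : ∀ k : Term N, IsIterWeakDeriv volume k.word u (G k))
    (hL : ∀ k : Term N, MemLp (expWeight (k.logExponent c α₁ α₂) (G k)) p)
    {η : ℝ≥0∞} (hη : 0 < η) (hη' : η ≠ ⊤) :
    ∃ w : Space N → F, IsTensor w ∧ ∀ k : Term N,
      eLpNorm (expWeight (k.logExponent c α₁ α₂) (G k - iterDeriv k.word w)) p volume ≤ 6 * η := by
  -- mollify `u`
  obtain ⟨K₁, K₂, h1, h2, hc1, hc2, hK⟩ := exists_forall_kernel hp1.le hp hG hL hη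
  set v₀ := (fun z : Space N => K₁ z.1 * K₂ z.2) ⋆[ContinuousLinearMap.lsmul ℝ ℝ, volume] u with hv₀
  have hKs : ContDiff ℝ ∞ fun z : Space N => K₁ z.1 * K₂ z.2 :=
    (h1.comp contDiff_fst).mul (h2.comp contDiff_snd)
  have hu : LocallyIntegrable u volume := by
    have e : u = fun z => Real.exp (-c * z.2) • expWeight c (G .val) z := by
      funext z
      rw [show G .val = u from (hG .val).symm]
      simp [expWeight, smul_smul, ← Real.exp_add]
    rw [e]
    exact ((hL .val).locallyIntegrable hp1.le).continuous_smul (by fun_prop)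
  have hs₀ : ContDiff ℝ ∞ v₀ :=
    (hasCompactSupport_mul_prod hc1 hc2).contDiff_convolution_left (n := ⊤) _ hKs hu
  have hm₀ : ∀ k : Term N, AEStronglyMeasurable (expWeight (k.logExponent c α₁ α₂)
      (iterDeriv k.word v₀ - G k)) volume := fun k => by
    rw [expWeight_sub]
    exact (continuous_expWeight _ (contDiff_iterDeriv hs₀ _).continuous).aestronglyMeasurable.sub
      (hL k).1
  have hmem₀ : MemLog p c α₁ α₂ v₀ := by
    refine ⟨hs₀, fun k => ?_⟩
    have := (show MemLp _ p volume from ⟨hm₀ k, (hK k).trans_lt hη'.lt_top⟩).add (hL k)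
    rwa [← expWeight_add, sub_add_cancel] at this
  -- cut off
  obtain ⟨v₁, hmem₁, hvc, e₁⟩ := hmem₀.exists_hasCompactSupport hp1 hp hα hc hη hη'
  -- mollify again, and replace the convolution by a Riemann sum
  obtain ⟨J₁, J₂, g1, g2, gc1, gc2, hJ⟩ := exists_forall_kernel hp1.le hp
    (fun k : Term N => isIterWeakDeriv_iterDeriv (μ := volume) hmem₁.contDiff k.word)
    hmem₁.memLp hη
  have hJs : ContDiff ℝ ∞ fun z : Space N => J₁ z.1 * J₂ z.2 :=
    (g1.comp contDiff_fst).mul (g2.comp contDiff_snd)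
  have hJc := hasCompactSupport_mul_prod gc1 gc2
  obtain ⟨t, d, htd⟩ := exists_riemannSum (μ := volume) hJs hJc hmem₁.contDiff hvc
  set v₂ := (fun z : Space N => J₁ z.1 * J₂ z.2) ⋆[ContinuousLinearMap.lsmul ℝ ℝ, volume] v₁
  have hs₂ : ContDiff ℝ ∞ v₂ :=
    hJc.contDiff_convolution_left (n := ⊤) _ hJs hmem₁.contDiff.continuous.locallyIntegrable
  obtain ⟨n, hn⟩ := (eventually_all.2 fun k : Term N => (htd p hp
    (fun z => Real.exp (k.logExponent c α₁ α₂ * z.2)) (by fun_prop) k.word).eventually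
    (ge_mem_nhds hη : ∀ᶠ x in 𝓝 (0 : ℝ≥0∞), x ≤ η)).exists
  set w : Space N → F := fun z => ∑ q ∈ t n, (J₁ (z - q).1 * J₂ (z - q).2) • d n q with hw
  have hwt : IsTensor w :=
    ⟨t n, fun q x => J₁ (x - q.1), fun q s => J₂ (s - q.2), d n,
      fun q => ⟨by fun_prop, gc1.comp_homeomorph (Homeomorph.subRight q.1)⟩,
      fun q => ⟨by fun_prop, gc2.comp_homeomorph (Homeomorph.subRight q.2)⟩, rfl⟩
  refine ⟨w, hwt, fun k => ?_⟩
  have hc' : ∀ {v : Space N → F}, ContDiff ℝ ∞ v → Continuous (iterDeriv k.word v) := fun hv =>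
    (contDiff_iterDeriv hv _).continuous
  set a := k.logExponent c α₁ α₂
  have m₁ : AEStronglyMeasurable (expWeight a (iterDeriv k.word v₀ - iterDeriv k.word v₁))
      (volume : Measure (Space N)) :=
    (continuous_expWeight _ ((hc' hs₀).sub (hc' hmem₁.contDiff))).aestronglyMeasurable
  have m₂ : AEStronglyMeasurable (expWeight a (iterDeriv k.word v₂ - iterDeriv k.word v₁))
      (volume : Measure (Space N)) :=
    (continuous_expWeight _ ((hc' hs₂).sub (hc' hmem₁.contDiff))).aestronglyMeasurable
  have m₃ : AEStronglyMeasurable (expWeight a (iterDeriv k.word w - iterDeriv k.word v₂))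
      (volume : Measure (Space N)) :=
    (continuous_expWeight _ ((hc' hwt.contDiff).sub (hc' hs₂))).aestronglyMeasurable
  have e : expWeight a (G k - iterDeriv k.word w) =
      (expWeight a (iterDeriv k.word v₀ - iterDeriv k.word v₁)
        - expWeight a (iterDeriv k.word v₀ - G k))
      - (expWeight a (iterDeriv k.word w - iterDeriv k.word v₂)
        + expWeight a (iterDeriv k.word v₂ - iterDeriv k.word v₁)) := by
    simp only [expWeight_sub]; abel
  rw [e]
  calc _ ≤ _ := eLpNorm_sub_le (m₁.sub (hm₀ k)) (m₃.add m₂) hp1.le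
    _ ≤ ((η + η + η) + η) + (η + η) := by
      gcongr
      · exact (eLpNorm_sub_le m₁ (hm₀ k) hp1.le).trans (add_le_add (e₁ k) (hK k))
      · exact (eLpNorm_add_le m₃ m₂ hp1.le).trans (add_le_add (hn k) (hJ k))
    _ = 6 * η := by ring

end WeightedSobolev

/-! ### The change of variables `y = exp s` -/

namespace WeightedSobolev

section Extension

variable {X Y F : Type*} [NormedAddCommGroup X] [NormedSpace ℝ X] [NormedAddCommGroup Y]
  [NormedSpace ℝ Y] [NormedAddCommGroup F] [NormedSpace ℝ F]

/-- A smooth compactly supported function, transported by a diffeomorphism `e` from the whole space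
onto an open set `Ω` and extended by zero. -/
theorem indicator_comp_isTest {Ω : Set Y} (hΩ : IsOpen Ω) {e : X → Y} {ℓ : Y → X}
    (he : Continuous e) (heΩ : ∀ x, e x ∈ Ω)
    (hel : ∀ y ∈ Ω, e (ℓ y) = y) (hℓ : ∀ y ∈ Ω, ContDiffAt ℝ ∞ ℓ y) {ψ : X → F}
    (hψ : ContDiff ℝ ∞ ψ) (hψc : HasCompactSupport ψ) :
    ContDiff ℝ ∞ (Ω.indicator (ψ ∘ ℓ)) ∧ HasCompactSupport (Ω.indicator (ψ ∘ ℓ)) ∧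
      tsupport (Ω.indicator (ψ ∘ ℓ)) ⊆ Ω := by
  have hK : IsCompact (e '' tsupport ψ) := hψc.isCompact.image he
  have hsub : Function.support (Ω.indicator (ψ ∘ ℓ)) ⊆ e '' tsupport ψ := by
    intro y hy
    have hyΩ : y ∈ Ω := mem_of_indicator_ne_zero hy
    rw [Function.mem_support, indicator_of_mem hyΩ] at hy
    exact ⟨ℓ y, subset_tsupport _ hy, hel y hyΩ⟩
  have hts : tsupport (Ω.indicator (ψ ∘ ℓ)) ⊆ e '' tsupport ψ :=
    closure_minimal hsub hK.isClosed
  have htΩ : tsupport (Ω.indicator (ψ ∘ ℓ)) ⊆ Ω := by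
    refine hts.trans ?_
    rintro _ ⟨x, _, rfl⟩
    exact heΩ x
  refine ⟨contDiff_iff_contDiffAt.2 fun y => ?_,
    hK.of_isClosed_subset (isClosed_tsupport _) hts, htΩ⟩
  by_cases hy : y ∈ tsupport (Ω.indicator (ψ ∘ ℓ))
  swap
  · exact (contDiffAt_const (c := 0)).congr_of_eventuallyEq
      (notMem_tsupport_iff_eventuallyEq.1 hy)
  refine ((hψ.contDiffAt).comp y (hℓ y (htΩ hy))).congr_of_eventuallyEq ?_
  filter_upwards [hΩ.mem_nhds (htΩ hy)] with w hw
  exact indicator_of_mem hw _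

end Extension

variable {N : ℕ}

/-- The change of variables `(x, s) ↦ (x, exp s)`. -/
def expMap (z : Space N) : Space N := (z.1, Real.exp z.2)

/-- The inverse change of variables `(x, y) ↦ (x, log y)`. -/
def logMap (z : Space N) : Space N := (z.1, Real.log z.2)

theorem contDiff_expMap : ContDiff ℝ ∞ (expMap (N := N)) := by
  unfold expMap; fun_prop

theorem expMap_mem (z : Space N) : expMap z ∈ (halfSpace N : Set (Space N)) := Real.exp_pos z.2

theorem logMap_expMap (z : Space N) : logMap (expMap z) = z := by simp [logMap, expMap]

theorem expMap_logMap {z : Space N} (hz : z ∈ (halfSpace N : Set (Space N))) :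
    expMap (logMap z) = z := by
  have : 0 < z.2 := hz
  simp [logMap, expMap, Real.exp_log this]

theorem contDiffAt_logMap {z : Space N} (hz : z ∈ (halfSpace N : Set (Space N))) :
    ContDiffAt ℝ ∞ (logMap (N := N)) z := by
  have h : 0 < z.2 := hz
  exact contDiffAt_fst.prodMk (contDiffAt_snd.log h.ne')

theorem measurableEmbedding_expMap : MeasurableEmbedding (expMap (N := N)) :=
  contDiff_expMap.continuous.measurableEmbedding
    (Function.LeftInverse.injective logMap_expMap)

/-- The measure `exp s dx ds`, which the change of variables sends to `dx dy` on the half-space. -/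
def expMeasure (N : ℕ) : Measure (Space N) :=
  (volume : Measure (Space N)).withDensity fun z => ENNReal.ofReal (Real.exp z.2)

theorem map_expMap_expMeasure :
    (expMeasure N).map expMap = volume.restrict (halfSpace N : Set (Space N)) := by
  have h1 : ((volume : Measure ℝ).withDensity fun s => ENNReal.ofReal (Real.exp s)).map Real.exp =
      volume.restrict (Ioi 0) := by
    have h := map_withDensity_abs_det_fderiv_eq_addHaar (volume : Measure ℝ)
      (s := univ) MeasurableSet.univ.nullMeasurableSet
      (fun x _ => (Real.hasDerivAt_exp x).hasFDerivAt.hasFDerivWithinAt) Real.exp_injective.injOn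
    rw [image_univ, Real.range_exp, Measure.restrict_univ] at h
    simpa using h
  have h2 : (halfSpace N : Set (Space N)) = univ ×ˢ Ioi 0 := by
    ext z; simp [halfSpace]
  rw [h2, Measure.volume_eq_prod, ← Measure.prod_restrict, Measure.restrict_univ, ← h1]
  have h3 := Measure.map_prod_map (volume : Measure (EuclideanSpace ℝ (Fin N)))
    ((volume : Measure ℝ).withDensity fun s => ENNReal.ofReal (Real.exp s))
    measurable_id Real.measurable_exp
  rw [Measure.map_id] at h3
  rw [h3, prod_withDensity_right (by fun_prop)]
  rfl

theorem expMeasure_ac : expMeasure N ≪ volume := withDensity_absolutelyContinuous _ _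

theorem ac_expMeasure : (volume : Measure (Space N)) ≪ expMeasure N :=
  withDensity_absolutelyContinuous' (by fun_prop) (Eventually.of_forall fun z => by
    simpa using Real.exp_pos z.2)

theorem ae_expMap {P : Space N → Prop}
    (h : ∀ᵐ z ∂(volume : Measure (Space N)), z ∈ halfSpace N → P z) :
    ∀ᵐ z ∂(volume : Measure (Space N)), P (expMap z) := by
  refine ac_expMeasure.ae_le (?_ : ∀ᵐ z ∂expMeasure N, P (expMap z))
  rw [← measurableEmbedding_expMap.ae_map_iff, map_expMap_expMeasure,
    ae_restrict_iff' (halfSpace N).isOpen.measurableSet]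
  exact h

variable {F : Type*} [NormedAddCommGroup F] [NormedSpace ℝ F]

theorem setIntegral_halfSpace_eq (f : Space N → F) :
    ∫ z in (halfSpace N : Set (Space N)), f z = ∫ z : Space N, Real.exp z.2 • f (expMap z) := by
  rw [← map_expMap_expMeasure, measurableEmbedding_expMap.integral_map]
  have : expMeasure N = (volume : Measure (Space N)).withDensity
      fun z => ((Real.toNNReal (Real.exp z.2) : NNReal) : ℝ≥0∞) := rfl
  rw [this, integral_withDensity_eq_integral_smul (by fun_prop)]
  refine integral_congr_ae (Eventually.of_forall fun z => ?_)
  simp [NNReal.smul_def, Real.exp_nonneg]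

theorem locallyIntegrable_comp_expMap {f : Space N → F}
    (hf : LocallyIntegrableOn f (halfSpace N) volume) :
    LocallyIntegrable (fun z => f (expMap z)) volume := by
  rw [locallyIntegrable_iff]
  intro K hK
  have h1 : IntegrableOn f (expMap '' K) (volume.restrict (halfSpace N : Set (Space N))) := by
    have : IntegrableOn f (expMap '' K) volume := by
      refine hf.integrableOn_compact_subset ?_ (hK.image contDiff_expMap.continuous)
      rintro _ ⟨z, _, rfl⟩
      exact expMap_mem z
    exact this.mono_measure Measure.restrict_le_self
  rw [← map_expMap_expMeasure, measurableEmbedding_expMap.integrableOn_map_iff,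
    preimage_image_eq _ (Function.LeftInverse.injective logMap_expMap), IntegrableOn, expMeasure,
    restrict_withDensity hK.measurableSet,
    integrable_withDensity_iff_integrable_smul' (by fun_prop) (by simp)] at h1
  have h2 : IntegrableOn (fun z => Real.exp z.2 • f (expMap z)) K volume := by
    refine h1.congr (Eventually.of_forall fun z => ?_)
    simp [Real.exp_nonneg]
  have h3 := IntegrableOn.continuousOn_smul (f := fun z : Space N => Real.exp (-z.2))
    h2 (by fun_prop) hK
  refine h3.congr (Eventually.of_forall fun z => ?_)
  simp [smul_smul, ← Real.exp_add]

theorem aestronglyMeasurable_weightMeasure_iff {F : Type*} [NormedAddCommGroup F] {m : ℝ}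
    {f : Space N → F} : AEStronglyMeasurable f (weightMeasure N m) ↔
      AEStronglyMeasurable (fun z => f (expMap z)) volume := by
  have hmeas : Measurable fun z : Space N => ENNReal.ofReal (z.2 ^ m) := by fun_prop
  have h1 : weightMeasure N m ≪ volume.restrict (halfSpace N : Set (Space N)) :=
    withDensity_absolutelyContinuous _ _
  have h2 : volume.restrict (halfSpace N : Set (Space N)) ≪ weightMeasure N m := by
    refine withDensity_absolutelyContinuous' hmeas.aemeasurable ?_
    rw [ae_restrict_iff' (halfSpace N).isOpen.measurableSet]
    refine Eventually.of_forall fun z hz => ?_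
    simpa using Real.rpow_pos_of_pos (show 0 < z.2 from hz) m
  have h3 : AEStronglyMeasurable f (volume.restrict (halfSpace N : Set (Space N))) ↔
      AEStronglyMeasurable (fun z => f (expMap z)) (expMeasure N) := by
    rw [← map_expMap_expMeasure, measurableEmbedding_expMap.aestronglyMeasurable_map_iff]
    rfl
  exact ⟨fun h => (h3.1 (h.mono_ac h2)).mono_ac ac_expMeasure,
    fun h => (h3.2 (h.mono_ac expMeasure_ac)).mono_ac h1⟩

/-- The norm of `L^p_m` in the coordinates `(x, s)`: with the Jacobian, `y ^ m dy` becomes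
`exp ((m + 1) s) ds`. -/
theorem eLpNorm_weightMeasure {p m : ℝ} (hp : 0 < p) (f : Space N → F) :
    eLpNorm f (ENNReal.ofReal p) (weightMeasure N m) =
      eLpNorm (expWeight ((m + 1) / p) fun z => f (expMap z)) (ENNReal.ofReal p) volume := by
  have hmeas : Measurable fun z : Space N => ENNReal.ofReal (z.2 ^ m) := by fun_prop
  have hp0 : ENNReal.ofReal p ≠ 0 := by simpa using hp
  rw [eLpNorm_eq_lintegral_rpow_enorm_toReal hp0 ENNReal.ofReal_ne_top,
    eLpNorm_eq_lintegral_rpow_enorm_toReal hp0 ENNReal.ofReal_ne_top,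
    ENNReal.toReal_ofReal hp.le]
  congr 1
  rw [weightMeasure, lintegral_withDensity_eq_lintegral_mul_non_measurable _ hmeas (by simp),
    ← map_expMap_expMeasure, measurableEmbedding_expMap.lintegral_map, expMeasure,
    lintegral_withDensity_eq_lintegral_mul_non_measurable _ (by fun_prop) (by simp)]
  refine lintegral_congr fun z => ?_
  simp only [Pi.mul_apply, expWeight, expMap, enorm_smul]
  rw [ENNReal.mul_rpow_of_nonneg _ _ hp.le, ← mul_assoc,
    ← ENNReal.ofReal_mul (Real.exp_nonneg _), Real.enorm_of_nonneg (Real.exp_nonneg _),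
    ENNReal.ofReal_rpow_of_nonneg (Real.exp_nonneg _) hp.le, ← Real.exp_mul, ← Real.exp_mul,
    ← Real.exp_add]
  congr 4
  field_simp
  ring

theorem expWeight_weight_comp_expMap {𝕜 : Type*} [RCLike 𝕜] (b a : ℝ) (f : Space N → 𝕜) :
    (expWeight b fun z => weight a f (expMap z)) = expWeight (b + a) fun z => f (expMap z) := by
  funext z
  simp only [expWeight, weight, expMap, smul_smul]
  rw [← Real.exp_mul, ← Real.exp_add]
  congr 2; ring

theorem normLpm_weight {𝕜 : Type*} [RCLike 𝕜] {p m : ℝ} (hp : 0 < p) (a : ℝ) (f : Space N → 𝕜) :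
    normLpm p m (weight a f) =
      eLpNorm (expWeight ((m + 1) / p + a) fun z => f (expMap z)) (ENNReal.ofReal p) volume := by
  rw [normLpm, eLpNorm_weightMeasure hp, expWeight_weight_comp_expMap]

theorem memLpm_iff {𝕜 : Type*} [RCLike 𝕜] {p m : ℝ} (hp : 0 < p) (f : Space N → 𝕜) :
    MemLpm p m f ↔
      MemLp (expWeight ((m + 1) / p) fun z => f (expMap z)) (ENNReal.ofReal p) volume := by
  have h : AEStronglyMeasurable (fun z => f (expMap z)) volume ↔
      AEStronglyMeasurable (expWeight ((m + 1) / p) fun z => f (expMap z)) volume := by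
    have hc : ∀ b : ℝ, Continuous fun z : Space N => Real.exp (b * z.2) := fun b => by fun_prop
    refine ⟨fun h => (hc _).aestronglyMeasurable.smul h, fun h => ?_⟩
    have := (hc (-((m + 1) / p))).aestronglyMeasurable.smul h
    refine this.congr (Eventually.of_forall fun z => ?_)
    simp [expWeight, smul_smul, ← Real.exp_add]
  rw [MemLpm, MemLp, MemLp, eLpNorm_weightMeasure hp, aestronglyMeasurable_weightMeasure_iff, h]

theorem memLpm_weight_iff {𝕜 : Type*} [RCLike 𝕜] {p m : ℝ} (hp : 0 < p) (a : ℝ)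
    (f : Space N → 𝕜) : MemLpm p m (weight a f) ↔
      MemLp (expWeight ((m + 1) / p + a) fun z => f (expMap z)) (ENNReal.ofReal p) volume := by
  rw [memLpm_iff hp, expWeight_weight_comp_expMap]

end WeightedSobolev

/-! ### Weak derivatives and the change of variables -/

namespace WeightedSobolev

variable {N : ℕ} {F : Type*} [NormedAddCommGroup F] [NormedSpace ℝ F]

/-- Smooth functions with compact support in the half-space. -/
structure IsTest (φ : Space N → F) : Prop where
  contDiff : ContDiff ℝ ∞ φ
  hasCompactSupport : HasCompactSupport φ
  tsupport_subset : tsupport φ ⊆ (halfSpace N : Set (Space N))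

protected theorem IsTest.iterDeriv {φ : Space N → F} (hφ : IsTest φ) (l : List (Space N)) :
    IsTest (iterDeriv l φ) :=
  ⟨contDiff_iterDeriv hφ.contDiff l, hφ.hasCompactSupport.iterDeriv l,
    (tsupport_iterDeriv_subset φ l).trans hφ.tsupport_subset⟩

theorem IsTest.eq_zero {φ : Space N → F} (hφ : IsTest φ) {z : Space N}
    (hz : z ∉ (halfSpace N : Set (Space N))) : φ z = 0 :=
  image_eq_zero_of_notMem_tsupport fun h => hz (hφ.tsupport_subset h)

theorem IsTest.zero : IsTest (0 : Space N → F) :=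
  ⟨contDiff_const, HasCompactSupport.zero, by simp [tsupport]⟩

theorem IsTest.add {φ ψ : Space N → F} (hφ : IsTest φ) (hψ : IsTest ψ) : IsTest (φ + ψ) :=
  ⟨hφ.contDiff.add hψ.contDiff, hφ.hasCompactSupport.add hψ.hasCompactSupport,
    (tsupport_add φ ψ).trans (union_subset hφ.tsupport_subset hψ.tsupport_subset)⟩

theorem IsTest.hasCompactSupport_comp_expMap {φ : Space N → F} (hφ : IsTest φ) :
    HasCompactSupport fun z => φ (expMap z) := by
  have hK : IsCompact (logMap '' tsupport φ) :=
    hφ.hasCompactSupport.isCompact.image_of_continuousOn fun z hz =>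
      (contDiffAt_logMap (hφ.tsupport_subset hz)).continuousAt.continuousWithinAt
  refine HasCompactSupport.intro hK fun z hz => ?_
  refine image_eq_zero_of_notMem_tsupport fun h => hz ⟨_, h, logMap_expMap z⟩

theorem IsTest.contDiff_comp_expMap {φ : Space N → F} (hφ : IsTest φ) :
    ContDiff ℝ ∞ fun z => φ (expMap z) :=
  hφ.contDiff.comp contDiff_expMap

theorem fderiv_comp_expMap {φ : Space N → F} (hφ : ContDiff ℝ ∞ φ) (z v : Space N) :
    fderiv ℝ (fun z => φ (expMap z)) z v =
      fderiv ℝ φ (expMap z) (v.1, Real.exp z.2 * v.2) := by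
  have h1 : HasFDerivAt (expMap (N := N))
      ((ContinuousLinearMap.fst ℝ (EuclideanSpace ℝ (Fin N)) ℝ).prod
        (Real.exp z.2 • ContinuousLinearMap.snd ℝ (EuclideanSpace ℝ (Fin N)) ℝ)) z :=
    hasFDerivAt_fst.prodMk hasFDerivAt_snd.exp
  have h2 := (hφ.differentiable (by simp) (expMap z)).hasFDerivAt.comp z h1
  rw [show fderiv ℝ (fun z => φ (expMap z)) z = _ from h2.fderiv]
  rfl

theorem fderiv_comp_expMap_some {φ : Space N → F} (hφ : ContDiff ℝ ∞ φ) (i : Fin N) (z : Space N) :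
    fderiv ℝ (fun z => φ (expMap z)) z (dir N (some i)) =
      fderiv ℝ φ (expMap z) (dir N (some i)) := by
  rw [fderiv_comp_expMap hφ]; simp [dir]

theorem fderiv_comp_expMap_none {φ : Space N → F} (hφ : ContDiff ℝ ∞ φ) (z : Space N) :
    fderiv ℝ (fun z => φ (expMap z)) z (dir N none) =
      Real.exp z.2 • fderiv ℝ φ (expMap z) (dir N none) := by
  rw [fderiv_comp_expMap hφ, ← map_smul]; simp [dir]

/-- A test function in the coordinates `(x, s)`, as a test function on the half-space. -/
theorem exists_testFunction {ψ : Space N → ℝ} (hψ : ContDiff ℝ ∞ ψ) (hψc : HasCompactSupport ψ) :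
    ∃ φ : TestFunction (halfSpace N) ℝ ⊤, ∀ z, φ (expMap z) = ψ z := by
  obtain ⟨h1, h2, h3⟩ := indicator_comp_isTest (halfSpace N).isOpen contDiff_expMap.continuous
    expMap_mem (fun _ h => expMap_logMap h) (fun _ h => contDiffAt_logMap h) hψ hψc
  refine ⟨⟨_, h1, h2, h3⟩, fun z => ?_⟩
  change (halfSpace N : Set (Space N)).indicator (ψ ∘ logMap) (expMap z) = ψ z
  rw [indicator_of_mem (expMap_mem z), Function.comp_apply, logMap_expMap]

section Transport

variable {𝕜 : Type*} [RCLike 𝕜]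

theorem isWeakDeriv_comp_expMap_some {i : Fin N} {u g : Space N → 𝕜}
    (h : HasWeakDeriv (some i) u g) :
    IsWeakDeriv volume (dir N (some i)) (fun z => u (expMap z)) fun z => g (expMap z) := by
  refine ⟨locallyIntegrable_comp_expMap h.locallyIntegrableOn,
    locallyIntegrable_comp_expMap h.locallyIntegrableOn_deriv, fun ψ hψ hψc => ?_⟩
  -- the factor `exp (-s)` absorbs the Jacobian
  have hψ' : ContDiff ℝ ∞ fun z : Space N => Real.exp (-z.2) * ψ z := by fun_prop
  obtain ⟨φ, hφ⟩ := exists_testFunction hψ' hψc.mul_left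
  have e := h.integral_eq φ
  rw [setIntegral_halfSpace_eq, setIntegral_halfSpace_eq] at e
  have h1 : ∀ z : Space N, Real.exp z.2 • (lineDeriv ℝ φ (expMap z) (dir N (some i)) •
      u (expMap z)) = fderiv ℝ ψ z (dir N (some i)) • u (expMap z) := by
    intro z
    rw [(φ.contDiff.differentiable (by simp) _).lineDeriv_eq_fderiv,
      ← fderiv_comp_expMap_some φ.contDiff, show (fun z => φ (expMap z)) = _ from funext hφ]
    have d1 : DifferentiableAt ℝ (fun z : Space N => Real.exp (-z.2)) z := by fun_prop
    have d2 : fderiv ℝ (fun z : Space N => Real.exp (-z.2)) z (dir N (some i)) = 0 := by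
      have : HasFDerivAt (fun z : Space N => Real.exp (-z.2)) (Real.exp (-z.2) •
        -(ContinuousLinearMap.snd ℝ (EuclideanSpace ℝ (Fin N)) ℝ)) z := hasFDerivAt_snd.neg.exp
      rw [this.fderiv]; simp [dir]
    rw [fderiv_fun_mul d1 (hψ.differentiable (by simp) z)]
    simp only [add_apply, smul_apply, d2, smul_eq_mul,
      mul_zero, add_zero, smul_smul, ← mul_assoc, ← Real.exp_add]
    simp
  have h2 : ∀ z : Space N, Real.exp z.2 • (φ (expMap z) • g (expMap z)) =
      ψ z • g (expMap z) := by
    intro z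
    rw [hφ, smul_smul, ← mul_assoc, ← Real.exp_add]
    simp
  simpa only [h1, h2] using e

theorem isWeakDeriv_comp_expMap_none {u g : Space N → 𝕜} (h : HasWeakDeriv none u g) :
    IsWeakDeriv volume (dir N none) (fun z => u (expMap z))
      fun z => Real.exp z.2 • g (expMap z) := by
  refine ⟨locallyIntegrable_comp_expMap h.locallyIntegrableOn,
    (locallyIntegrable_comp_expMap h.locallyIntegrableOn_deriv).continuous_smul (by fun_prop),
    fun ψ hψ hψc => ?_⟩
  obtain ⟨φ, hφ⟩ := exists_testFunction hψ hψc
  have e := h.integral_eq φ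
  rw [setIntegral_halfSpace_eq, setIntegral_halfSpace_eq] at e
  have h1 : ∀ z : Space N, Real.exp z.2 • (lineDeriv ℝ φ (expMap z) (dir N none) •
      u (expMap z)) = fderiv ℝ ψ z (dir N none) • u (expMap z) := by
    intro z
    rw [(φ.contDiff.differentiable (by simp) _).lineDeriv_eq_fderiv, smul_smul, ← smul_eq_mul,
      ← fderiv_comp_expMap_none φ.contDiff, show (fun z => φ (expMap z)) = _ from funext hφ]
  have h2 : ∀ z : Space N, Real.exp z.2 • (φ (expMap z) • g (expMap z)) =
      ψ z • Real.exp z.2 • g (expMap z) := by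
    intro z
    rw [hφ, smul_comm]
  simpa only [h1, h2] using e

/-- The product rule for the weak derivative in `s` of `exp s • f`. -/
theorem isWeakDeriv_exp_smul {f g : Space N → F} (h : IsWeakDeriv volume (dir N none) f g) :
    IsWeakDeriv volume (dir N none) (fun z => Real.exp z.2 • f z)
      fun z => Real.exp z.2 • f z + Real.exp z.2 • g z := by
  have hc : Continuous fun z : Space N => Real.exp z.2 := by fun_prop
  have hf := h.locallyIntegrable.continuous_smul hc
  have hg := h.locallyIntegrable_deriv.continuous_smul hc
  refine ⟨hf, hf.add hg, fun ψ hψ hψc => ?_⟩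
  have hψ' : ContDiff ℝ ∞ fun z : Space N => Real.exp z.2 * ψ z := by fun_prop
  have e := h.integral_eq _ hψ' hψc.mul_left
  have d2 : ∀ z, fderiv ℝ (fun z : Space N => Real.exp z.2 * ψ z) z (dir N none) • f z =
      ψ z • Real.exp z.2 • f z + fderiv ℝ ψ z (dir N none) • Real.exp z.2 • f z := by
    intro z
    have h1 : HasFDerivAt (fun z : Space N => Real.exp z.2) (Real.exp z.2 •
        (ContinuousLinearMap.snd ℝ (EuclideanSpace ℝ (Fin N)) ℝ)) z := hasFDerivAt_snd.exp
    rw [fderiv_fun_mul h1.differentiableAt (hψ.differentiable (by simp) z), h1.fderiv]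
    simp only [dir, add_apply, smul_apply, smul_eq_mul,
      ContinuousLinearMap.coe_snd', mul_one, smul_smul, ← add_smul]
    congr 1; ring
  have i1 := hf.integrable_smul_left_of_hasCompactSupport hψ.continuous hψc
  have i2 := hg.integrable_smul_left_of_hasCompactSupport hψ.continuous hψc
  have i3 : Integrable (fun z => fderiv ℝ ψ z (dir N none) • Real.exp z.2 • f z) volume :=
    hf.integrable_smul_left_of_hasCompactSupport (contDiff_iterDeriv hψ [dir N none]).continuous
      (hψc.iterDeriv [dir N none])
  simp_rw [d2] at e
  rw [integral_add i1 i3] at e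
  simp_rw [smul_add]
  rw [integral_add i1 i2, neg_add, ← sub_eq_neg_add, eq_sub_iff_add_eq, add_comm, e]
  congr 1
  refine integral_congr_ae (Eventually.of_forall fun z => ?_)
  simp only [smul_smul, mul_comm]

theorem IsTest.hasWeakDeriv {φ : Space N → 𝕜} (hφ : IsTest φ) (i : Option (Fin N)) :
    HasWeakDeriv i φ (iterDeriv [dir N i] φ) := by
  refine ⟨hφ.contDiff.continuous.locallyIntegrable.locallyIntegrableOn _,
    (hφ.iterDeriv [dir N i]).contDiff.continuous.locallyIntegrable.locallyIntegrableOn _,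
    fun ψ => ?_⟩
  rw [setIntegral_eq_integral_of_forall_compl_eq_zero fun z hz => by
      rw [hφ.eq_zero hz, smul_zero],
    setIntegral_eq_integral_of_forall_compl_eq_zero fun z hz => by
      rw [(hφ.iterDeriv [dir N i]).eq_zero hz, smul_zero]]
  have e := (isWeakDeriv_fderiv (μ := volume) hφ.contDiff (dir N i)).integral_eq ψ ψ.contDiff
    ψ.hasCompactSupport
  rw [← show _ = -∫ z, ψ z • iterDeriv [dir N i] φ z from e]
  refine integral_congr_ae (Eventually.of_forall fun z => ?_)
  simp only
  rw [(ψ.contDiff.differentiable (by simp) _).lineDeriv_eq_fderiv]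

theorem HasWeakDeriv.sub {i : Option (Fin N)} {u v g h : Space N → 𝕜}
    (hu : HasWeakDeriv i u g) (hv : HasWeakDeriv i v h) : HasWeakDeriv i (u - v) (g - h) := by
  refine ⟨hu.locallyIntegrableOn.sub hv.locallyIntegrableOn,
    hu.locallyIntegrableOn_deriv.sub hv.locallyIntegrableOn_deriv, fun ψ => ?_⟩
  have int : ∀ (η : Space N → ℝ), Continuous η → HasCompactSupport η →
      tsupport η ⊆ (halfSpace N : Set (Space N)) → ∀ k : Space N → 𝕜,
      LocallyIntegrableOn k (halfSpace N) volume →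
      IntegrableOn (fun z => η z • k z) (halfSpace N) volume := by
    intro η hη hc hs k hk
    have h1 : IntegrableOn (fun z => η z • k z) (tsupport η) volume :=
      (hk.integrableOn_compact_subset hs hc).continuousOn_smul hη.continuousOn hc
    refine ((integrableOn_iff_integrable_of_support_subset ?_).1 h1).integrableOn
    intro z hz
    exact subset_tsupport η fun h0 => hz (by simp [h0])
  have hψ : IsTest ψ := ⟨ψ.contDiff, ψ.hasCompactSupport, ψ.tsupport_subset⟩
  have hd : IsTest fun z => lineDeriv ℝ ψ z (dir N i) := by
    have : (fun z => lineDeriv ℝ ψ z (dir N i)) = iterDeriv [dir N i] ψ := by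
      funext z
      exact (ψ.contDiff.differentiable (by simp) _).lineDeriv_eq_fderiv
    rw [this]; exact hψ.iterDeriv _
  have I := int _ hd.contDiff.continuous hd.hasCompactSupport hd.tsupport_subset
  have J := int _ hψ.contDiff.continuous hψ.hasCompactSupport hψ.tsupport_subset
  simp only [Pi.sub_apply, smul_sub]
  rw [integral_sub (I _ hu.locallyIntegrableOn) (I _ hv.locallyIntegrableOn),
    integral_sub (J _ hu.locallyIntegrableOn_deriv) (J _ hv.locallyIntegrableOn_deriv),
    hu.integral_eq, hv.integral_eq]
  abel

theorem HasWeakDeriv.congr {i : Option (Fin N)} {u v g : Space N → 𝕜}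
    (hu : HasWeakDeriv i u g)
    (huv : ∀ᵐ z ∂(volume : Measure (Space N)), z ∈ halfSpace N → u z = v z) :
    HasWeakDeriv i v g := by
  have hr : u =ᵐ[volume.restrict (halfSpace N : Set (Space N))] v :=
    (ae_restrict_iff' (halfSpace N).isOpen.measurableSet).2 huv
  refine ⟨fun z hz => ?_, hu.locallyIntegrableOn_deriv, fun ψ => ?_⟩
  · obtain ⟨s, hs, hi⟩ := hu.locallyIntegrableOn z hz
    refine ⟨s ∩ halfSpace N, inter_mem hs self_mem_nhdsWithin, ?_⟩
    exact (hi.mono_set inter_subset_left).congr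
      (ae_restrict_of_ae_restrict_of_subset inter_subset_right hr)
  · rw [← hu.integral_eq]
    refine integral_congr_ae ?_
    filter_upwards [hr] with z hz
    rw [hz]

end Transport

end WeightedSobolev

/-! ### Transport of the approximation to the half-space -/

namespace WeightedSobolev

variable {N : ℕ} {𝕜 : Type*} [RCLike 𝕜]

/-- The derivatives of `u (x, exp s)` in the coordinates `(x, s)` that correspond to the terms of
the norm, in terms of the first derivatives `D` and of the second derivatives `DD` of `u`:
`D_s = y D_y` and `D_s² = y D_y + y² D_y²`. -/
def logTerm (u : Space N → 𝕜) (D : Option (Fin N) → Space N → 𝕜)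
    (DD : Option (Fin N) → Option (Fin N) → Space N → 𝕜) : Term N → Space N → 𝕜
  | .val => fun z => u (expMap z)
  | .dx i => fun z => D (some i) (expMap z)
  | .dxx i j => fun z => DD (some i) (some j) (expMap z)
  | .dy => fun z => Real.exp z.2 • D none (expMap z)
  | .dyN => fun z => Real.exp z.2 • D none (expMap z)
  | .dyy => fun z => Real.exp z.2 • D none (expMap z) +
      Real.exp z.2 • Real.exp z.2 • DD none none (expMap z)

/-- The terms of a function on the half-space, formed with its weak derivatives. -/
def weakTerm (u : Space N → 𝕜) : Term N → Space N → 𝕜 :=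
  logTerm u (fun i => weakDeriv i u) fun i j => weakDeriv i (weakDeriv j u)

theorem isIterWeakDeriv_weakTerm {p : ℝ} {u : Space N → 𝕜} (hu : MemW2pLoc p u) (k : Term N) :
    IsIterWeakDeriv volume k.word (fun z => u (expMap z)) (weakTerm u k) := by
  have h1 : ∀ i, HasWeakDeriv i u (weakDeriv i u) := fun i => by
    obtain ⟨g, hg⟩ := (hu.1.2 i).1
    exact hasWeakDeriv_weakDeriv hg
  have h2 : ∀ i j, HasWeakDeriv i (weakDeriv j u) (weakDeriv i (weakDeriv j u)) := fun i j => by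
    obtain ⟨g, hg⟩ := ((hu.2 j).2 i).1
    exact hasWeakDeriv_weakDeriv hg
  match k with
  | .val => rfl
  | .dx i => exact ⟨_, rfl, isWeakDeriv_comp_expMap_some (h1 _)⟩
  | .dxx i j => exact ⟨_, ⟨_, rfl, isWeakDeriv_comp_expMap_some (h1 _)⟩,
      isWeakDeriv_comp_expMap_some (h2 _ _)⟩
  | .dy => exact ⟨_, rfl, isWeakDeriv_comp_expMap_none (h1 _)⟩
  | .dyN => exact ⟨_, rfl, isWeakDeriv_comp_expMap_none (h1 _)⟩
  | .dyy => exact ⟨_, ⟨_, rfl, isWeakDeriv_comp_expMap_none (h1 _)⟩,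
      isWeakDeriv_exp_smul (isWeakDeriv_comp_expMap_none (h2 _ _))⟩

theorem iterDeriv_comp_expMap {φ : Space N → 𝕜} (hφ : ContDiff ℝ ∞ φ) (k : Term N) :
    iterDeriv k.word (fun z => φ (expMap z)) =
      logTerm φ (fun i => iterDeriv [dir N i] φ) (fun i j => iterDeriv [dir N i, dir N j] φ) k := by
  have hx : ∀ {ψ : Space N → 𝕜}, ContDiff ℝ ∞ ψ → ∀ i,
      iterDeriv [dir N (some i)] (fun z => ψ (expMap z)) =
        fun z => iterDeriv [dir N (some i)] ψ (expMap z) := fun hψ i =>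
    funext fun z => fderiv_comp_expMap_some hψ i z
  have hy : ∀ {ψ : Space N → 𝕜}, ContDiff ℝ ∞ ψ →
      iterDeriv [dir N none] (fun z => ψ (expMap z)) =
        fun z => Real.exp z.2 • iterDeriv [dir N none] ψ (expMap z) := fun hψ =>
    funext fun z => fderiv_comp_expMap_none hψ z
  match k with
  | .val => rfl
  | .dx i => exact hx hφ i
  | .dxx i j =>
    have : iterDeriv [dir N (some i), dir N (some j)] (fun z => φ (expMap z)) =
      iterDeriv [dir N (some i)] (iterDeriv [dir N (some j)] fun z => φ (expMap z)) := rfl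
    simp only [Term.word, logTerm]
    rw [this, hx hφ j, hx (contDiff_iterDeriv hφ _) i]
    rfl
  | .dy => exact hy hφ
  | .dyN => exact hy hφ
  | .dyy =>
    have : iterDeriv [dir N none, dir N none] (fun z => φ (expMap z)) =
      iterDeriv [dir N none] (iterDeriv [dir N none] fun z => φ (expMap z)) := rfl
    simp only [Term.word, logTerm]
    have hexp : iterDeriv [dir N none] (fun z : Space N => Real.exp z.2) =
        fun z => Real.exp z.2 := by
      funext z
      have h1 : HasFDerivAt (fun z : Space N => Real.exp z.2) (Real.exp z.2 •
        (ContinuousLinearMap.snd ℝ (EuclideanSpace ℝ (Fin N)) ℝ)) z := hasFDerivAt_snd.exp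
      simp [iterDeriv, h1.fderiv, dir]
    have hs : ContDiff ℝ ∞ fun z : Space N => Real.exp z.2 := by fun_prop
    have hc : ContDiff ℝ ∞ fun z => iterDeriv [dir N none] φ (expMap z) :=
      (contDiff_iterDeriv hφ _).comp contDiff_expMap
    rw [this, hy hφ, iterDeriv_singleton_smul hs hc, hexp, hy (contDiff_iterDeriv hφ _)]
    funext z
    rw [add_comm]
    rfl

theorem expWeight_exp_smul (a : ℝ) (f : Space N → 𝕜) :
    (expWeight a fun z => Real.exp z.2 • f z) = expWeight (a + 1) f := by
  funext z
  simp only [expWeight, smul_smul, ← Real.exp_add]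
  congr 2; ring

theorem memLp_weakTerm {p α₁ α₂ m : ℝ} (hp : 0 < p) {u : Space N → 𝕜} (hu : MemWN p α₁ α₂ m u)
    (k : Term N) :
    MemLp (expWeight (k.logExponent ((m + 1) / p) α₁ α₂) (weakTerm u k)) (ENNReal.ofReal p)
      volume := by
  obtain ⟨⟨_, h0, hxx, hx, hyy, hy⟩, hN⟩ := hu
  rw [memLpm_weight_iff hp] at hyy hy hN
  match k with
  | .val => exact (memLpm_iff hp _).1 h0
  | .dx i => exact (memLpm_weight_iff hp _ _).1 (hx i)
  | .dxx i j => exact (memLpm_weight_iff hp _ _).1 (hxx i j)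
  | .dy =>
    simp only [weakTerm, logTerm, Term.logExponent]
    rw [expWeight_exp_smul, sub_add_cancel]
    exact hy
  | .dyN =>
    simp only [weakTerm, logTerm, Term.logExponent]
    rw [expWeight_exp_smul, show (m + 1) / p + α₂ - 2 + 1 = (m + 1) / p + (α₂ - 1) by ring]
    exact hN
  | .dyy =>
    have e : expWeight ((m + 1) / p + α₂ - 2) (weakTerm u .dyy) =
        (expWeight ((m + 1) / p + (α₂ - 1)) fun z => weakDeriv none u (expMap z)) +
        expWeight ((m + 1) / p + α₂) fun z => weakDeriv none (weakDeriv none u) (expMap z) := by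
      obtain ⟨b, hb⟩ : ∃ b, b = (m + 1) / p + α₂ - 2 := ⟨_, rfl⟩
      rw [← hb, show (m + 1) / p + (α₂ - 1) = b + 1 by rw [hb]; ring,
        show (m + 1) / p + α₂ = b + 1 + 1 by rw [hb]; ring, ← expWeight_exp_smul,
        ← expWeight_exp_smul, ← expWeight_exp_smul, ← expWeight_add]
      rfl
    simp only [Term.logExponent]
    rw [e]
    exact hN.add hyy

/-- The norm is controlled by the terms in the coordinates `(x, s)`. The term with `D_y²` counts
twice, since `y² D_y² = D_s² - D_s`. -/
theorem normWN_le {p α₁ α₂ m : ℝ} (hp : 1 ≤ p) {v : Space N → 𝕜} {η : ℝ≥0∞}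
    (hm : ∀ k : Term N, AEStronglyMeasurable
      (expWeight (k.logExponent ((m + 1) / p) α₁ α₂) (weakTerm v k)) volume)
    (h : ∀ k : Term N, eLpNorm (expWeight (k.logExponent ((m + 1) / p) α₁ α₂) (weakTerm v k))
      (ENNReal.ofReal p) volume ≤ η) :
    normWN p α₁ α₂ m v ≤ (N * N + N + 5 : ℕ) * η := by
  have hp0 : 0 < p := by linarith
  have h1 : normLpm p m v ≤ η := by
    rw [normLpm, eLpNorm_weightMeasure hp0]; exact h .val
  have h2 : ∀ i j : Fin N,
      normLpm p m (weight α₁ (weakDeriv (some i) (weakDeriv (some j) v))) ≤ η := fun i j => by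
    rw [normLpm_weight hp0]; exact h (.dxx i j)
  have h3 : ∀ i : Fin N, normLpm p m (weight (α₁ / 2) (weakDeriv (some i) v)) ≤ η := fun i => by
    rw [normLpm_weight hp0]; exact h (.dx i)
  have h4 : normLpm p m (weight (α₂ / 2) (weakDeriv none v)) ≤ η := by
    rw [normLpm_weight hp0]
    have := h .dy
    simp only [weakTerm, logTerm, Term.logExponent] at this
    rwa [expWeight_exp_smul, sub_add_cancel] at this
  have h5 : normLpm p m (weight (α₂ - 1) (weakDeriv none v)) ≤ η := by
    rw [normLpm_weight hp0]
    have := h .dyN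
    simp only [weakTerm, logTerm, Term.logExponent] at this
    rwa [expWeight_exp_smul, show (m + 1) / p + α₂ - 2 + 1 = (m + 1) / p + (α₂ - 1) by ring]
      at this
  have h6 : normLpm p m (weight α₂ (weakDeriv none (weakDeriv none v))) ≤ η + η := by
    rw [normLpm_weight hp0]
    have e : (expWeight ((m + 1) / p + α₂)
        fun z => weakDeriv none (weakDeriv none v) (expMap z)) =
        expWeight (Term.logExponent ((m + 1) / p) α₁ α₂ (.dyy : Term N)) (weakTerm v .dyy) -
        expWeight (Term.logExponent ((m + 1) / p) α₁ α₂ (.dyN : Term N)) (weakTerm v .dyN) := by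
      simp only [Term.logExponent]
      obtain ⟨b, hb⟩ : ∃ b, b = (m + 1) / p + α₂ - 2 := ⟨_, rfl⟩
      rw [← hb, show (m + 1) / p + α₂ = b + 1 + 1 by rw [hb]; ring, ← expWeight_exp_smul,
        ← expWeight_exp_smul, ← expWeight_sub]
      congr 1
      funext z
      simp [weakTerm, logTerm]
    rw [e]
    exact (eLpNorm_sub_le (hm .dyy) (hm .dyN) (by simpa using hp)).trans
      (add_le_add (h .dyy) (h .dyN))
  have s2 : ∑ i : Fin N, ∑ j : Fin N,
      normLpm p m (weight α₁ (weakDeriv (some i) (weakDeriv (some j) v))) ≤ (N * N : ℕ) * η := by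
    refine (Finset.sum_le_sum fun i _ => Finset.sum_le_sum fun j _ => h2 i j).trans ?_
    simp [mul_assoc]
  have s3 : ∑ i : Fin N, normLpm p m (weight (α₁ / 2) (weakDeriv (some i) v)) ≤ N * η := by
    refine (Finset.sum_le_sum fun i _ => h3 i).trans ?_
    simp
  rw [normWN, normW]
  calc _ ≤ η + (N * N : ℕ) * η + N * η + (η + η) + η + η := by gcongr
    _ = _ := by push_cast; ring

/-- The weak derivatives of `u - φ` for a test function `φ`. -/
theorem weakTerm_sub_ae {p : ℝ} {u φ : Space N → 𝕜} (hu : MemW2pLoc p u) (hφ : IsTest φ)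
    (k : Term N) :
    weakTerm (u - φ) k =ᵐ[volume]
      weakTerm u k - iterDeriv k.word fun z => φ (expMap z) := by
  have h1 : ∀ i, HasWeakDeriv i u (weakDeriv i u) := fun i => by
    obtain ⟨g, hg⟩ := (hu.1.2 i).1
    exact hasWeakDeriv_weakDeriv hg
  have h2 : ∀ i j, HasWeakDeriv i (weakDeriv j u) (weakDeriv i (weakDeriv j u)) := fun i j => by
    obtain ⟨g, hg⟩ := ((hu.2 j).2 i).1
    exact hasWeakDeriv_weakDeriv hg
  have s1 : ∀ i, HasWeakDeriv i (u - φ) (weakDeriv i u - iterDeriv [dir N i] φ) := fun i =>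
    (h1 i).sub (hφ.hasWeakDeriv i)
  have e1 : ∀ i, ∀ᵐ z ∂(volume : Measure (Space N)), z ∈ halfSpace N →
      weakDeriv i (u - φ) z = (weakDeriv i u - iterDeriv [dir N i] φ) z := fun i =>
    (hasWeakDeriv_weakDeriv (s1 i)).ae_unique (s1 i)
  have s2 : ∀ i j, HasWeakDeriv i (weakDeriv j (u - φ))
      (weakDeriv i (weakDeriv j u) - iterDeriv [dir N i, dir N j] φ) := fun i j => by
    refine ((h2 i j).sub ((hφ.iterDeriv [dir N j]).hasWeakDeriv i)).congr ?_
    filter_upwards [e1 j] with z hz hzm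
    exact (hz hzm).symm
  have e2 : ∀ i j, ∀ᵐ z ∂(volume : Measure (Space N)), z ∈ halfSpace N →
      weakDeriv i (weakDeriv j (u - φ)) z =
        (weakDeriv i (weakDeriv j u) - iterDeriv [dir N i, dir N j] φ) z := fun i j =>
    (hasWeakDeriv_weakDeriv (s2 i j)).ae_unique (s2 i j)
  have e1' := fun i => ae_expMap (e1 i)
  have e2' := fun i j => ae_expMap (e2 i j)
  rw [iterDeriv_comp_expMap hφ.contDiff]
  match k with
  | .val => exact EventuallyEq.rfl
  | .dx i => exact e1' (some i)
  | .dxx i j => exact e2' (some i) (some j)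
  | .dy =>
    filter_upwards [e1' none] with z hz
    simp only [weakTerm, logTerm, Pi.sub_apply] at hz ⊢
    rw [hz, smul_sub]
  | .dyN =>
    filter_upwards [e1' none] with z hz
    simp only [weakTerm, logTerm, Pi.sub_apply] at hz ⊢
    rw [hz, smul_sub]
  | .dyy =>
    filter_upwards [e1' none, e2' none none] with z hz hz'
    simp only [weakTerm, logTerm, Pi.sub_apply] at hz hz' ⊢
    rw [hz, hz']
    simp only [smul_sub]
    abel

theorem memLpLoc_of_ae {p : ℝ} {f φ : Space N → 𝕜} (hφ : IsTest φ)
    (h : ∀ᵐ z ∂(volume : Measure (Space N)), z ∈ halfSpace N → f z = φ z) : MemLpLoc p f := by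
  intro K hK hKs
  have h1 : MemLp φ (ENNReal.ofReal p) (volume.restrict K) :=
    (hφ.contDiff.continuous.memLp_of_hasCompactSupport hφ.hasCompactSupport).restrict K
  refine (memLp_congr_ae ?_).2 h1
  rw [EventuallyEq, ae_restrict_iff' hK.measurableSet]
  filter_upwards [h] with z hz hzK
  exact hz (hKs hzK)

theorem memLpm_weight_of_ae {p m : ℝ} (hp : 0 < p) (a : ℝ) {f φ : Space N → 𝕜} (hφ : IsTest φ)
    (h : ∀ᵐ z ∂(volume : Measure (Space N)), z ∈ halfSpace N → f z = φ z) :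
    MemLpm p m (weight a f) := by
  rw [memLpm_weight_iff hp]
  have h1 : MemLp (expWeight ((m + 1) / p + a) fun z => φ (expMap z)) (ENNReal.ofReal p) volume :=
    (continuous_expWeight _ hφ.contDiff_comp_expMap.continuous).memLp_of_hasCompactSupport
      hφ.hasCompactSupport_comp_expMap.smul_left
  refine (memLp_congr_ae ?_).2 h1
  filter_upwards [ae_expMap h] with z hz
  simp only [expWeight, hz]

theorem IsTest.memWN {p α₁ α₂ m : ℝ} (hp : 0 < p) {φ : Space N → 𝕜} (hφ : IsTest φ) :
    MemWN p α₁ α₂ m φ := by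
  have e1 : ∀ i, ∀ᵐ z ∂(volume : Measure (Space N)), z ∈ halfSpace N →
      weakDeriv i φ z = iterDeriv [dir N i] φ z := fun i =>
    (hasWeakDeriv_weakDeriv (hφ.hasWeakDeriv i)).ae_unique (hφ.hasWeakDeriv i)
  have s2 : ∀ i j, HasWeakDeriv i (weakDeriv j φ) (iterDeriv [dir N i, dir N j] φ) := fun i j => by
    refine ((hφ.iterDeriv [dir N j]).hasWeakDeriv i).congr ?_
    filter_upwards [e1 j] with z hz hzm
    exact (hz hzm).symm
  have e2 : ∀ i j, ∀ᵐ z ∂(volume : Measure (Space N)), z ∈ halfSpace N →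
      weakDeriv i (weakDeriv j φ) z = iterDeriv [dir N i, dir N j] φ z := fun i j =>
    (hasWeakDeriv_weakDeriv (s2 i j)).ae_unique (s2 i j)
  have t1 := fun i => hφ.iterDeriv [dir N i]
  have t2 := fun i j => hφ.iterDeriv [dir N i, dir N j]
  refine ⟨⟨⟨⟨memLpLoc_of_ae hφ (Eventually.of_forall fun _ _ => rfl), fun i =>
    ⟨⟨_, hφ.hasWeakDeriv i⟩, memLpLoc_of_ae (t1 i) (e1 i)⟩⟩,
    fun j => ⟨memLpLoc_of_ae (t1 j) (e1 j), fun i =>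
      ⟨⟨_, s2 i j⟩, memLpLoc_of_ae (t2 i j) (e2 i j)⟩⟩⟩, ?_,
    fun i j => memLpm_weight_of_ae hp _ (t2 _ _) (e2 _ _),
    fun i => memLpm_weight_of_ae hp _ (t1 _) (e1 _),
    memLpm_weight_of_ae hp _ (t2 _ _) (e2 _ _),
    memLpm_weight_of_ae hp _ (t1 _) (e1 _)⟩, memLpm_weight_of_ae hp _ (t1 _) (e1 _)⟩
  have := memLpm_weight_of_ae (m := m) hp 0 hφ (Eventually.of_forall fun _ _ => rfl)
  have e : weight 0 φ = φ := by funext z; simp [weight]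
  rwa [e] at this

theorem isTest_of_mem_smoothCompact {φ : Space N → 𝕜} (h : φ ∈ smoothCompact 𝕜 N) : IsTest φ := by
  obtain ⟨f, rfl⟩ := h
  exact ⟨f.contDiff, f.hasCompactSupport, f.tsupport_subset⟩

theorem IsTest.mem_smoothCompact {φ : Space N → 𝕜} (h : IsTest φ) : φ ∈ smoothCompact 𝕜 N :=
  ⟨⟨φ, h.contDiff, h.hasCompactSupport, h.tsupport_subset⟩, rfl⟩

theorem isTest_of_mem_smoothCompactTensor {φ : Space N → 𝕜} (h : φ ∈ smoothCompactTensor 𝕜 N) :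
    IsTest φ := by
  obtain ⟨n, f, g, rfl⟩ := h
  have h1 : ∀ k, IsTest fun z : Space N => f k z.1 * g k z.2 := by
    intro k
    have hK : IsCompact (tsupport (f k) ×ˢ tsupport (g k)) :=
      (f k).hasCompactSupport.isCompact.prod (g k).hasCompactSupport.isCompact
    have hsub : tsupport (fun z : Space N => f k z.1 * g k z.2) ⊆
        tsupport (f k) ×ˢ tsupport (g k) := by
      refine closure_minimal (fun z hz => ?_) hK.isClosed
      exact ⟨subset_tsupport _ (left_ne_zero_of_mul hz),
        subset_tsupport _ (right_ne_zero_of_mul hz)⟩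
    refine ⟨((f k).contDiff.comp contDiff_fst).mul ((g k).contDiff.comp contDiff_snd),
      hK.of_isClosed_subset (isClosed_tsupport _) hsub, hsub.trans fun z hz => ?_⟩
    exact (g k).tsupport_subset hz.2
  have h2 : ∀ t : Finset (Fin n), IsTest (∑ k ∈ t, fun z : Space N => f k z.1 * g k z.2) := by
    intro t
    induction t using Finset.cons_induction with
    | empty => simpa using IsTest.zero
    | cons k t hk ih => rw [Finset.sum_cons]; exact (h1 k).add ih
  have h3 := h2 Finset.univ
  convert h3 using 1
  funext z
  simp

/-- A tensor product in the coordinates `(x, s)` is one in the coordinates `(x, y)`. -/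
theorem IsTensor.exists_mem_smoothCompactTensor {w : Space N → 𝕜} (hw : IsTensor w) :
    ∃ φ ∈ smoothCompactTensor 𝕜 N, (fun z => φ (expMap z)) = w := by
  obtain ⟨t, f, g, d, hf, hg, rfl⟩ := hw
  have hF : ∀ q, ∃ F : TestFunction (⊤ : Opens (EuclideanSpace ℝ (Fin N))) 𝕜 ⊤,
      ∀ x, F x = f q x • d q := fun q =>
    ⟨⟨fun x => f q x • d q, (hf q).1.smul contDiff_const, (hf q).2.smul_right, fun _ _ => trivial⟩,
      fun _ => rfl⟩
  have hG : ∀ q, ∃ G : TestFunction halfLine 𝕜 ⊤, ∀ s, G (Real.exp s) = ((g q s : ℝ) : 𝕜) := by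
    intro q
    have hs : ContDiff ℝ ∞ fun s => ((g q s : ℝ) : 𝕜) := by
      have h : ContDiff ℝ ∞ fun s => g q s • (1 : 𝕜) := (hg q).1.smul contDiff_const
      simpa only [RCLike.real_smul_eq_coe_mul, mul_one] using h
    obtain ⟨h1, h2, h3⟩ := indicator_comp_isTest (Ω := Ioi (0 : ℝ)) (e := Real.exp)
      (ℓ := Real.log) isOpen_Ioi Real.continuous_exp Real.exp_pos (fun y hy => Real.exp_log hy)
      (fun y hy => contDiffAt_id.log (ne_of_gt hy)) hs ((hg q).2.comp_left (RCLike.ofReal_zero))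
    refine ⟨⟨_, h1, h2, h3⟩, fun s => ?_⟩
    change (Ioi (0 : ℝ)).indicator ((fun s => ((g q s : ℝ) : 𝕜)) ∘ Real.log) (Real.exp s) = _
    rw [indicator_of_mem (mem_Ioi.2 (Real.exp_pos s))]
    simp
  choose F hF using hF
  choose G hG using hG
  refine ⟨_, ⟨t.card, fun k => F (t.equivFin.symm k), fun k => G (t.equivFin.symm k), rfl⟩, ?_⟩
  funext z
  simp only [expMap]
  rw [← Finset.sum_coe_sort t, ← t.equivFin.symm.sum_comp]
  refine Finset.sum_congr rfl fun k _ => ?_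
  rw [hF, hG, mul_smul, RCLike.real_smul_eq_coe_mul, RCLike.real_smul_eq_coe_mul,
    RCLike.real_smul_eq_coe_mul]
  ring

/-- Density of the tensor products, by transport of `exists_isTensor` to the half-space. -/
theorem exists_mem_smoothCompactTensor_normWN_sub_lt {p α₁ α₂ m : ℝ} (hp : 1 < p) (hα : α₂ < 2)
    (hc : 2 - α₂ ≤ (m + 1) / p) {u : Space N → 𝕜} (hu : MemWN p α₁ α₂ m u) {ε : ℝ≥0∞}
    (hε : 0 < ε) : ∃ φ ∈ smoothCompactTensor 𝕜 N, normWN p α₁ α₂ m (u - φ) < ε := by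
  have hp0 : 0 < p := by linarith
  obtain ⟨η, hη, hlt⟩ := ENNReal.exists_nnreal_pos_mul_lt
    (a := ((N * N + N + 5 : ℕ) : ℝ≥0∞) * 6)
    (ENNReal.mul_ne_top (ENNReal.natCast_ne_top _) ENNReal.ofNat_ne_top) hε.ne'
  obtain ⟨w, hw, hk⟩ := exists_isTensor (p := ENNReal.ofReal p) (c := (m + 1) / p) (α₁ := α₁)
    (by simpa using hp) ENNReal.ofReal_ne_top hα hc (isIterWeakDeriv_weakTerm hu.1.memW2pLoc)
    (memLp_weakTerm hp0 hu) (η := η) (by simpa using hη) ENNReal.coe_ne_top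
  obtain ⟨φ, hφ, rfl⟩ := hw.exists_mem_smoothCompactTensor
  have hφt := isTest_of_mem_smoothCompactTensor hφ
  refine ⟨φ, hφ, lt_of_le_of_lt (normWN_le (η := 6 * η) hp.le (fun k => ?_) fun k => ?_) ?_⟩
  · have : AEStronglyMeasurable (expWeight (k.logExponent ((m + 1) / p) α₁ α₂)
        (weakTerm u k - iterDeriv k.word fun z => φ (expMap z))) volume := by
      rw [expWeight_sub]
      exact (memLp_weakTerm hp0 hu k).1.sub (continuous_expWeight _
        (contDiff_iterDeriv hφt.contDiff_comp_expMap _).continuous).aestronglyMeasurable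
    refine this.congr ?_
    filter_upwards [weakTerm_sub_ae hu.1.memW2pLoc hφt k] with z hz
    simp only [expWeight, hz]
  · refine le_trans (le_of_eq (eLpNorm_congr_ae ?_)) (hk k)
    filter_upwards [weakTerm_sub_ae hu.1.memW2pLoc hφt k] with z hz
    simp only [expWeight, hz]
  · rwa [← mul_assoc, mul_comm]

end WeightedSobolev
end

theorem mainTheorem8 {𝕜 : Type*} [RCLike 𝕜] (N : ℕ) (p α₁ α₂ m : ℝ)
    (hp : 1 < p) (hα₂ : α₂ < 2)
    (h₁ : 2 - α₂ ≤ (m + 1) / p) (h₂ : α₁⁻ < (m + 1) / p) :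
    WeightedSobolev.IsDenseInWN p α₁ α₂ m (WeightedSobolev.smoothCompact 𝕜 N) ∧
      WeightedSobolev.IsDenseInWN p α₁ α₂ m (WeightedSobolev.smoothCompactTensor 𝕜 N) := by
  have hp0 : 0 < p := by linarith
  refine ⟨⟨fun φ hφ => (WeightedSobolev.isTest_of_mem_smoothCompact hφ).memWN hp0,
    fun u hu ε hε => ?_⟩,
    fun φ hφ => (WeightedSobolev.isTest_of_mem_smoothCompactTensor hφ).memWN hp0,
    fun u hu ε hε =>
      WeightedSobolev.exists_mem_smoothCompactTensor_normWN_sub_lt hp hα₂ h₁ hu hε⟩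
  obtain ⟨φ, hφ, h⟩ :=
    WeightedSobolev.exists_mem_smoothCompactTensor_normWN_sub_lt hp hα₂ h₁ hu hε
  exact ⟨φ, (WeightedSobolev.isTest_of_mem_smoothCompactTensor hφ).mem_smoothCompact, h⟩
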